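/- Let $A\in\mathbb R^{m\times n}$ with $\operatorname{rank}(A)=m$, let $Q\in\mathbb R^{n\times n}$ be symmetric positive semi-definite, $b\in\mathbb R^m$, $c\in\mathbb R^n$, and consider the primal-dual pair $$(P)\ \min_x\ c^Tx+\tfrac12x^TQx\ \ \text{s.t. } Ax=b,\ x\ge 0,\qquad (D)\ \max_{x,y,z}\ b^Ty-\tfrac12x^TQx\ \ \text{s.t. } -Qx+A^Ty+z=c,\ z\ge0 .$$ A primal-dual solution of $(P)$-$(D)$ is a triple $(x,y,z)$ that satisfies the KKT conditions $c+Qx-A^Ty-z=0$, $Ax=b$, $x^iz^i=0$ for all $i$, $x\ge0$, $z\ge0$, and such that $x$ solves $(P)$ and $(x,y,z)$ solves $(D)$. Suppose that a primal-dual solution exists. Let $0<\sigma_{\min}\le\sigma_{\max}\le \tfrac12$, $C_N>0$, $\gamma_{\mathcal A},\gamma_\mu\in(0,1)$, $\rho>0$, $y_0\in\mathbb R^m$. Put $x_0=z_0=\rho e$ with $e=(1,\dots,1)^T\in\mathbb R^n$, $\zeta_0=x_0$, $\lambda_0=y_0$, $\mu_k=x_k^Tz_k/n$, $\bar b=Ax_0-b$,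 $\bar c=-Qx_0+A^Ty_0+z_0-c$, and $$\|(u,v)\|_{\mathcal A}=\min\{\|(x,z)\|_2:\ Ax=u,\ -Qx+A^Ty+z=v\}.$$ For $\mu\in\mathbb R$, let $\mathcal N_\mu(\zeta,\lambda)$ be the set of all $(x,y,z)$ with $x>0$, $z>0$, $x^iz^i\ge\gamma_\mu\mu$ for all $i$, for which there are $\tilde b,\tilde c$ with $\|(\tilde b,\tilde c)\|_2\le C_N$, $\|(\tilde b,\tilde c)\|_{\mathcal A}\le\gamma_{\mathcal A}\rho$ and $$Ax+\mu(y-\lambda)=b+\tfrac{\mu}{\mu_0}(\bar b+\tilde b),\qquad -Qx+A^Ty+z-\mu(x-\zeta)=c+\tfrac{\mu}{\mu_0}(\bar c+\tilde c).$$ Let $(x_k,y_k,z_k,\zeta_k,\lambda_k)_{k\ge0}$ be an infinite sequence generated from this starting point by the Interior Point-Proximal Method of Multipliers (IP-PMM), run without a positive stopping tolerance. At every iteration $k\ge 0$ the method does the following: 1. It chooses some $\sigma_k\in[\sigma_{\min},\sigma_{\max}]$ and a solution $(\Delta x,\Delta y,\Delta z)$ of $$\begin{aligned}-(Q+\mu_kI)\Delta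 x+A^T\Delta y+\Delta z&=-\big(-(c+\tfrac{\sigma_k\mu_k}{\mu_0}\bar c)-Qx_k+A^Ty_k+z_k-\sigma_k\mu_k(x_k-\zeta_k)\big),\\ A\Delta x+\mu_k\Delta y&=-\big(Ax_k+\sigma_k\mu_k(y_k-\lambda_k)-(b+\tfrac{\sigma_k\mu_k}{\mu_0}\bar b)\big),\\ z_k^i\Delta x^i+x_k^i\Delta z^i&=-(x_k^iz_k^i-\sigma_k\mu_k),\quad i=1,\dots,n.\end{aligned}$$ 2. It takes $\alpha_k$ as the largest $\alpha\in(0,1]$ such that, with $\mu_k(\alpha)=(x_k+\alpha\Delta x)^T(z_k+\alpha\Delta z)/n$, one has $\mu_k(\alpha)\le(1-0.01\alpha)\mu_k$ and $(x_k+\alpha\Delta x,\,y_k+\alpha\Delta y,\,z_k+\alpha\Delta z)\in\mathcal N_{\mu_k(\alpha)}(\zeta_k,\lambda_k)$, and sets $(x_{k+1},y_{k+1},z_{k+1})=(x_k,y_k,z_k)+\alpha_k(\Delta x,\Delta y,\Delta z)$. 3. It computes $r_p=Ax_{k+1}-(b+\tfrac{\mu_{k+1}}{\mu_0}\bar b)$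 and $r_d=-Qx_{k+1}+A^Ty_{k+1}+z_{k+1}-(c+\tfrac{\mu_{k+1}}{\mu_0}\bar c)$. If $\|(r_p,r_d)\|_2\le C_N\tfrac{\mu_{k+1}}{\mu_0}$ and $\|(r_p,r_d)\|_{\mathcal A}\le\gamma_{\mathcal A}\rho\tfrac{\mu_{k+1}}{\mu_0}$, it sets $(\zeta_{k+1},\lambda_{k+1})=(x_{k+1},y_{k+1})$; otherwise $(\zeta_{k+1},\lambda_{k+1})=(\zeta_k,\lambda_k)$. Then every limit point of the sequence $\{(x_k,y_k,z_k)\}$ is a primal-dual solution of $(P)$-$(D)$. -/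

import Mathlib

open Matrix Filter Topology

namespace IPPMM

/-- Data of the pair
(P) `min cᵀx + ½ xᵀQx` s.t. `Ax = b, x ≥ 0`, and
(D) `max bᵀy - ½ xᵀQx` s.t. `-Qx + Aᵀy + z = c, z ≥ 0`. -/
structure QP (m n : ℕ) where
  A : Matrix (Fin m) (Fin n) ℝ
  Q : Matrix (Fin n) (Fin n) ℝ
  b : Fin m → ℝ
  c : Fin n → ℝ

section Solutions

variable {m n : ℕ}

/-- Objective of (P). -/
noncomputable def primalObj (P : QP m n) (x : Fin n → ℝ) : ℝ :=
  P.c ⬝ᵥ x + (1 / 2) * (x ⬝ᵥ (P.Q *ᵥ x))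

/-- Objective of (D). -/
noncomputable def dualObj (P : QP m n) (x : Fin n → ℝ) (y : Fin m → ℝ) : ℝ :=
  P.b ⬝ᵥ y - (1 / 2) * (x ⬝ᵥ (P.Q *ᵥ x))

/-- Feasibility for (P). -/
def PrimalFeasible (P : QP m n) (x : Fin n → ℝ) : Prop :=
  P.A *ᵥ x = P.b ∧ ∀ i, 0 ≤ x i

/-- Feasibility for (D). -/
def DualFeasible (P : QP m n) (x : Fin n → ℝ) (y : Fin m → ℝ) (z : Fin n → ℝ) : Prop :=
  -(P.Q *ᵥ x) + P.Aᵀ *ᵥ y + z = P.c ∧ ∀ i, 0 ≤ z i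

/-- `x` is a global minimizer of (P). -/
def PrimalOptimal (P : QP m n) (x : Fin n → ℝ) : Prop :=
  PrimalFeasible P x ∧ ∀ x', PrimalFeasible P x' → primalObj P x ≤ primalObj P x'

/-- `(x, y, z)` is a global maximizer of (D). -/
def DualOptimal (P : QP m n) (x : Fin n → ℝ) (y : Fin m → ℝ) (z : Fin n → ℝ) : Prop :=
  DualFeasible P x y z ∧
    ∀ x' y' z', DualFeasible P x' y' z' → dualObj P x' y' ≤ dualObj P x y

/-- The Karush-Kuhn-Tucker conditions of the pair (P)-(D). -/
def IsKKT (P : QP m n) (x : Fin n → ℝ) (y : Fin m → ℝ) (z : Fin n → ℝ) : Prop :=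
  P.c + P.Q *ᵥ x - P.Aᵀ *ᵥ y - z = 0 ∧ P.A *ᵥ x - P.b = 0 ∧ (∀ i, x i * z i = 0) ∧
    (∀ i, 0 ≤ x i) ∧ (∀ i, 0 ≤ z i)

/-- `(x, y, z)` is a primal-dual solution of the pair (P)-(D): it satisfies the KKT conditions,
`x` solves (P) and `(x, y, z)` solves (D). -/
def IsPrimalDualSolution (P : QP m n) (x : Fin n → ℝ) (y : Fin m → ℝ) (z : Fin n → ℝ) : Prop :=
  IsKKT P x y z ∧ PrimalOptimal P x ∧ DualOptimal P x y z

end Solutions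

/-- The Euclidean norm of the stacked vector `(u, v) ∈ ℝ^(p + q)`. -/
noncomputable def norm2 {p q : ℕ} (u : Fin p → ℝ) (v : Fin q → ℝ) : ℝ :=
  ‖(WithLp.toLp 2 (Sum.elim u v) : EuclideanSpace ℝ (Fin p ⊕ Fin q))‖

/-- The semi-norm
`‖(u, v)‖_A = min {‖(x, z)‖₂ : Ax = u, -Qx + Aᵀy + z = v}`.
If `A` has full row rank, then the constraints are feasible for all `(u, v)`, and the infimum is
a minimum. -/
noncomputable def normA {m n : ℕ} (P : QP m n) (u : Fin m → ℝ) (v : Fin n → ℝ) : ℝ :=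
  sInf {r : ℝ | ∃ (x : Fin n → ℝ) (y : Fin m → ℝ) (z : Fin n → ℝ),
    P.A *ᵥ x = u ∧ -(P.Q *ᵥ x) + P.Aᵀ *ᵥ y + z = v ∧ r = norm2 x z}

/-- Parameters of the method: centering bounds, the constants of the neighbourhood, and the
scale `ρ` of the starting point. -/
structure Params where
  σmin : ℝ
  σmax : ℝ
  CN : ℝ
  γA : ℝ
  γμ : ℝ
  ρ : ℝ
  σmin_pos : 0 < σmin
  σmin_le : σmin ≤ σmax
  σmax_le : σmax ≤ 1 / 2
  CN_pos : 0 < CN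
  γA_pos : 0 < γA
  γA_lt : γA < 1
  γμ_pos : 0 < γμ
  γμ_lt : γμ < 1
  ρ_pos : 0 < ρ

/-- The state of the method at an iteration: the iterate `(x, y, z)` and the proximal estimates
`(ζ, η)`, where `ζ` estimates a primal solution and `η` a Lagrange multiplier vector. -/
structure State (m n : ℕ) where
  x : Fin n → ℝ
  y : Fin m → ℝ
  z : Fin n → ℝ
  ζ : Fin n → ℝ
  η : Fin m → ℝ

section Algorithm

variable {m n : ℕ}

/-- The complementarity measure `xᵀz / n`. -/
noncomputable def mu (x z : Fin n → ℝ) : ℝ := (x ⬝ᵥ z) / (n : ℝ)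

/-- The starting point `x₀ = z₀ = ρ e`, `ζ₀ = x₀`, `η₀ = y₀`. -/
def start (par : Params) (y₀ : Fin m → ℝ) : State m n where
  x := fun _ => par.ρ
  y := y₀
  z := fun _ => par.ρ
  ζ := fun _ => par.ρ
  η := y₀

/-- The initial complementarity measure `μ₀ = x₀ᵀz₀ / n`. -/
noncomputable def mu0 (n : ℕ) (par : Params) : ℝ :=
  mu (fun _ : Fin n => par.ρ) (fun _ : Fin n => par.ρ)

/-- The initial primal residual `b̄ = Ax₀ - b`. -/
def bbar (P : QP m n) (par : Params) : Fin m → ℝ :=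
  P.A *ᵥ (fun _ => par.ρ) - P.b

/-- The initial dual residual `c̄ = -Qx₀ + Aᵀy₀ + z₀ - c`. -/
def cbar (P : QP m n) (par : Params) (y₀ : Fin m → ℝ) : Fin n → ℝ :=
  -(P.Q *ᵥ (fun _ => par.ρ)) + P.Aᵀ *ᵥ y₀ + (fun _ => par.ρ) - P.c

/-- `(x, y, z)` lies in the neighbourhood `N_μ(ζ, η)`; the vectors `bt`, `ct` are the scaled
infeasibilities. -/
def InNbhd (P : QP m n) (par : Params) (y₀ : Fin m → ℝ) (μ : ℝ)
    (ζ : Fin n → ℝ) (η : Fin m → ℝ)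
    (x : Fin n → ℝ) (y : Fin m → ℝ) (z : Fin n → ℝ) : Prop :=
  (∃ (bt : Fin m → ℝ) (ct : Fin n → ℝ),
    P.A *ᵥ x + μ • (y - η) = P.b + (μ / mu0 n par) • (bbar P par + bt) ∧
    -(P.Q *ᵥ x) + P.Aᵀ *ᵥ y + z - μ • (x - ζ)
      = P.c + (μ / mu0 n par) • (cbar P par y₀ + ct) ∧
    norm2 bt ct ≤ par.CN ∧ normA P bt ct ≤ par.γA * par.ρ) ∧
  (∀ i, 0 < x i) ∧ (∀ i, 0 < z i) ∧ (∀ i, par.γμ * μ ≤ x i * z i)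

/-- `(dx, dy, dz)` solves the Newton system at the state `s`, with centering parameter `σ`. -/
def IsNewtonDir (P : QP m n) (par : Params) (y₀ : Fin m → ℝ) (s : State m n) (σ : ℝ)
    (dx : Fin n → ℝ) (dy : Fin m → ℝ) (dz : Fin n → ℝ) : Prop :=
  let μ := mu s.x s.z;
  (-((P.Q + μ • (1 : Matrix (Fin n) (Fin n) ℝ)) *ᵥ dx) + P.Aᵀ *ᵥ dy + dz
      = -(-(P.c + (σ * μ / mu0 n par) • cbar P par y₀) - P.Q *ᵥ s.x + P.Aᵀ *ᵥ s.y + s.z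
          - (σ * μ) • (s.x - s.ζ))) ∧
  P.A *ᵥ dx + μ • dy
      = -(P.A *ᵥ s.x + (σ * μ) • (s.y - s.η) - (P.b + (σ * μ / mu0 n par) • bbar P par)) ∧
  ∀ i, s.z i * dx i + s.x i * dz i = -(s.x i * s.z i - σ * μ)

/-- The step-lengths `a ∈ (0, 1]` that are admissible at the state `s` along `(dx, dy, dz)`. -/
def admissible (P : QP m n) (par : Params) (y₀ : Fin m → ℝ) (s : State m n)
    (dx : Fin n → ℝ) (dy : Fin m → ℝ) (dz : Fin n → ℝ) : Set ℝ :=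
  {a : ℝ | 0 < a ∧ a ≤ 1 ∧
    mu (s.x + a • dx) (s.z + a • dz) ≤ (1 - 0.01 * a) * mu s.x s.z ∧
    InNbhd P par y₀ (mu (s.x + a • dx) (s.z + a • dz)) s.ζ s.η
      (s.x + a • dx) (s.y + a • dy) (s.z + a • dz)}

/-- The test that decides whether the proximal estimates are moved to the iterate `(x, y, z)`.
Both residuals are taken with the signs that they have in the neighbourhood, so the test says that
`(x, y, z)` satisfies the residual conditions of the neighbourhood `N_μ(x, y)`. -/
def UpdateTest (P : QP m n) (par : Params) (y₀ : Fin m → ℝ)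
    (x : Fin n → ℝ) (y : Fin m → ℝ) (z : Fin n → ℝ) : Prop :=
  let μ := mu x z
  let rp := P.A *ᵥ x - (P.b + (μ / mu0 n par) • bbar P par)
  let rd := -(P.Q *ᵥ x) + P.Aᵀ *ᵥ y + z - (P.c + (μ / mu0 n par) • cbar P par y₀)
  norm2 rp rd ≤ par.CN * (μ / mu0 n par) ∧
    normA P rp rd ≤ par.γA * par.ρ * (μ / mu0 n par)

/-- One iteration of the method leads from `s` to `t`. -/
def Step (P : QP m n) (par : Params) (y₀ : Fin m → ℝ) (s t : State m n) : Prop :=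
  ∃ (σ a : ℝ) (dx : Fin n → ℝ) (dy : Fin m → ℝ) (dz : Fin n → ℝ),
    σ ∈ Set.Icc par.σmin par.σmax ∧
    IsNewtonDir P par y₀ s σ dx dy dz ∧
    IsGreatest (admissible P par y₀ s dx dy dz) a ∧
    t.x = s.x + a • dx ∧ t.y = s.y + a • dy ∧ t.z = s.z + a • dz ∧
    (UpdateTest P par y₀ t.x t.y t.z → t.ζ = t.x ∧ t.η = t.y) ∧
    (¬ UpdateTest P par y₀ t.x t.y t.z → t.ζ = s.ζ ∧ t.η = s.η)

/-- `s` is the sequence of states of a run of the method, with no positive tolerance that would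
stop it early. -/
def IsRun (P : QP m n) (par : Params) (y₀ : Fin m → ℝ) (s : ℕ → State m n) : Prop :=
  s 0 = start par y₀ ∧ ∀ k, Step P par y₀ (s k) (s (k + 1))

end Algorithm

end IPPMM

/-! The heart of the matter is that `μ_k` tends to `0` while the iterates and the proximal estimates
stay bounded. The KKT residuals at an iterate are `μ_k` times bounded vectors and `x^i z^i ≤ n μ_k`,
so every limit point is then a KKT point. Since `Q` is positive semidefinite, it is optimal for both
problems (`IsKKT.isPrimalDualSolution`).

Boundedness comes from comparing `(x, y, z)` in a neighbourhood with the mixture, in proportion `θ =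
μ/μ₀`, of a KKT point and the perturbed starting point. The `𝒜`-norm bound makes the perturbation
smaller than `ρ`, so the mixture has `x` and `z` entries at least a multiple of `θ`. Monotonicity of
the proximal KKT operator then bounds `∑ x + ∑ z` after division by `θ`
(`perturbed_residual_sum_le`, `exists_bound_of_inNbhd`). The proximal terms do no harm if the
estimates equal the iterate or are already bounded. The first case bounds every newly set estimate,
hence all estimates, and the second case then bounds all iterates (`IsRun.exists_bound`).

If `μ_k` stayed above some `μs > 0`, the proximal terms would keep the Newton systems uniformly well
conditioned and the directions bounded (`exists_newtonDir_bound`). The errors of a step of length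
`a` are of order `a²`, whereas centering gains at least `a σmin μs`, so one fixed step-length is
admissible throughout (`exists_admissible_step`). Then `μ_k` would decay geometrically, a
contradiction (`IsRun.tendsto_mu`). -/

namespace IPPMM

/-! ### Sup-norm estimates for dot products and matrices of full row rank -/

section Vectors

variable {p q : ℕ}

lemma abs_dotProduct_le (u v : Fin p → ℝ) : |u ⬝ᵥ v| ≤ p * (‖u‖ * ‖v‖) := by
  calc |u ⬝ᵥ v| ≤ ∑ i, |u i * v i| := Finset.abs_sum_le_sum_abs _ _
    _ ≤ ∑ _i : Fin p, ‖u‖ * ‖v‖ := by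
        refine Finset.sum_le_sum fun i _ => ?_
        rw [abs_mul]
        exact mul_le_mul (norm_le_pi_norm u i) (norm_le_pi_norm v i) (abs_nonneg _) (norm_nonneg _)
    _ = p * (‖u‖ * ‖v‖) := by simp

lemma sq_norm_le_dotProduct (u : Fin p → ℝ) : ‖u‖ ^ 2 ≤ u ⬝ᵥ u := by
  have h0 : 0 ≤ u ⬝ᵥ u := Finset.sum_nonneg fun i _ => mul_self_nonneg _
  have h : ‖u‖ ≤ √(u ⬝ᵥ u) := by
    refine (pi_norm_le_iff_of_nonneg (Real.sqrt_nonneg _)).2 fun i => ?_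
    refine Real.le_sqrt_of_sq_le ?_
    rw [Real.norm_eq_abs, sq_abs, sq]
    exact Finset.single_le_sum (f := fun i => u i * u i) (fun i _ => mul_self_nonneg _)
      (Finset.mem_univ i)
  calc ‖u‖ ^ 2 ≤ √(u ⬝ᵥ u) ^ 2 := by gcongr
    _ = _ := Real.sq_sqrt h0

lemma exists_norm_mulVec_le (B : Matrix (Fin p) (Fin q) ℝ) :
    ∃ K, 0 ≤ K ∧ ∀ x, ‖B *ᵥ x‖ ≤ K * ‖x‖ :=
  ⟨‖B.mulVecLin.toContinuousLinearMap‖, norm_nonneg _,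
    fun x => B.mulVecLin.toContinuousLinearMap.le_opNorm x⟩

lemma exists_rightInverse_of_rank (B : Matrix (Fin p) (Fin q) ℝ) (hB : B.rank = p) :
    ∃ K, 0 ≤ K ∧ ∀ u, ∃ x, B *ᵥ x = u ∧ ‖x‖ ≤ K * ‖u‖ := by
  have hr : LinearMap.range B.mulVecLin = ⊤ := by
    apply Submodule.eq_top_of_finrank_eq
    rw [← Matrix.rank, hB]; simp
  obtain ⟨g, hg⟩ := B.mulVecLin.exists_rightInverse_of_surjective hr
  refine ⟨‖g.toContinuousLinearMap‖, norm_nonneg _, fun u => ⟨g u, ?_, ?_⟩⟩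
  · exact LinearMap.congr_fun hg u
  · exact g.toContinuousLinearMap.le_opNorm u

lemma exists_norm_le_transpose_mulVec (B : Matrix (Fin p) (Fin q) ℝ) (hB : B.rank = p) :
    ∃ K, 0 ≤ K ∧ ∀ y, ‖y‖ ≤ K * ‖Bᵀ *ᵥ y‖ := by
  have hinj : Function.Injective Bᵀ.mulVecLin := by
    rw [← LinearMap.ker_eq_bot]
    have h := Bᵀ.mulVecLin.finrank_range_add_finrank_ker
    rw [← Matrix.rank, Matrix.rank_transpose, hB] at h
    simpa using h
  obtain ⟨K, -, hK⟩ := Bᵀ.mulVecLin.exists_antilipschitzWith (LinearMap.ker_eq_bot.2 hinj)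
  refine ⟨K, K.2, fun y => ?_⟩
  simpa [mulVec_transpose] using hK.le_mul_dist y 0

end Vectors

/-! ### The stacked Euclidean norm -/

section Norms

variable {p q : ℕ}

lemma norm2_nonneg (u : Fin p → ℝ) (v : Fin q → ℝ) : 0 ≤ norm2 u v := norm_nonneg _

lemma norm_left_le_norm2 (u : Fin p → ℝ) (v : Fin q → ℝ) : ‖u‖ ≤ norm2 u v :=
  (pi_norm_le_iff_of_nonneg (norm2_nonneg u v)).2 fun i =>
    PiLp.norm_apply_le (WithLp.toLp 2 (Sum.elim u v) : EuclideanSpace ℝ (Fin p ⊕ Fin q)) (Sum.inl i)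

lemma norm_right_le_norm2 (u : Fin p → ℝ) (v : Fin q → ℝ) : ‖v‖ ≤ norm2 u v :=
  (pi_norm_le_iff_of_nonneg (norm2_nonneg u v)).2 fun i =>
    PiLp.norm_apply_le (WithLp.toLp 2 (Sum.elim u v) : EuclideanSpace ℝ (Fin p ⊕ Fin q)) (Sum.inr i)

lemma norm2_add_smul_le (u u' : Fin p → ℝ) (v v' : Fin q → ℝ) {a t : ℝ} (ha : 0 ≤ a) (ht : 0 ≤ t) :
    norm2 (a • u + t • u') (a • v + t • v') ≤ a * norm2 u v + t * norm2 u' v' := by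
  have h : (WithLp.toLp 2 (Sum.elim (a • u + t • u') (a • v + t • v')) :
      EuclideanSpace ℝ (Fin p ⊕ Fin q))
      = a • WithLp.toLp 2 (Sum.elim u v) + t • WithLp.toLp 2 (Sum.elim u' v') := by
    ext i; rcases i with i | i <;> simp
  unfold norm2
  rw [h]
  refine (norm_add_le _ _).trans ?_
  rw [norm_smul, norm_smul, Real.norm_of_nonneg ha, Real.norm_of_nonneg ht]

lemma norm2_smul (u : Fin p → ℝ) (v : Fin q → ℝ) {a : ℝ} (ha : 0 ≤ a) :
    norm2 (a • u) (a • v) = a * norm2 u v := by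
  have h : (WithLp.toLp 2 (Sum.elim (a • u) (a • v)) : EuclideanSpace ℝ (Fin p ⊕ Fin q))
      = a • WithLp.toLp 2 (Sum.elim u v) := by
    ext i; rcases i with i | i <;> simp
  unfold norm2
  rw [h, norm_smul, Real.norm_of_nonneg ha]

lemma norm2_zero : norm2 (0 : Fin p → ℝ) (0 : Fin q → ℝ) = 0 := by
  simpa using norm2_smul (0 : Fin p → ℝ) (0 : Fin q → ℝ) (a := 0) le_rfl

lemma norm2_le_sum (u : Fin p → ℝ) (v : Fin q → ℝ) : norm2 u v ≤ (p + q) * (‖u‖ + ‖v‖) := by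
  unfold norm2
  rw [EuclideanSpace.norm_eq]
  apply Real.sqrt_le_iff.2 ⟨by positivity, ?_⟩
  have h1 : ∀ i : Fin p, u i ^ 2 ≤ (‖u‖ + ‖v‖) ^ 2 := fun i => by
    apply sq_le_sq'
    · have := neg_le_of_abs_le (norm_le_pi_norm u i); linarith [norm_nonneg v]
    · have := le_of_abs_le (norm_le_pi_norm u i); linarith [norm_nonneg v]
  have h2 : ∀ i : Fin q, v i ^ 2 ≤ (‖u‖ + ‖v‖) ^ 2 := fun i => by
    apply sq_le_sq'
    · have := neg_le_of_abs_le (norm_le_pi_norm v i); linarith [norm_nonneg u]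
    · have := le_of_abs_le (norm_le_pi_norm v i); linarith [norm_nonneg u]
  simp only [Fintype.sum_sum_type, Sum.elim_inl, Sum.elim_inr, Real.norm_eq_abs, sq_abs]
  calc _ ≤ ∑ _i : Fin p, (‖u‖ + ‖v‖) ^ 2 + ∑ _i : Fin q, (‖u‖ + ‖v‖) ^ 2 :=
        add_le_add (Finset.sum_le_sum fun i _ => h1 i) (Finset.sum_le_sum fun i _ => h2 i)
    _ = ((p + q : ℕ) : ℝ) * (‖u‖ + ‖v‖) ^ 2 := by simp; ring
    _ ≤ ((p + q : ℕ) : ℝ) ^ 2 * (‖u‖ + ‖v‖) ^ 2 := by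
        gcongr
        exact_mod_cast Nat.le_self_pow two_ne_zero _
    _ = _ := by push_cast; ring

end Norms

/-! ### The semi-norm `normA` -/

section NormA

variable {m n : ℕ} {P : QP m n}

lemma normA_le_norm2 {u : Fin m → ℝ} {v x : Fin n → ℝ} {y : Fin m → ℝ} {z : Fin n → ℝ}
    (h1 : P.A *ᵥ x = u) (h2 : -(P.Q *ᵥ x) + P.Aᵀ *ᵥ y + z = v) : normA P u v ≤ norm2 x z :=
  csInf_le ⟨0, by rintro r ⟨x, y, z, -, -, rfl⟩; exact norm2_nonneg _ _⟩ ⟨x, y, z, h1, h2, rfl⟩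

/-- Full row rank makes the constraint set nonempty. The strict inequality means that attainment of
the minimum is never needed. -/
lemma exists_norm2_lt_of_normA_lt (hA : P.A.rank = m) {u : Fin m → ℝ} {v : Fin n → ℝ} {r : ℝ}
    (h : normA P u v < r) : ∃ (x : Fin n → ℝ) (y : Fin m → ℝ) (z : Fin n → ℝ),
      P.A *ᵥ x = u ∧ -(P.Q *ᵥ x) + P.Aᵀ *ᵥ y + z = v ∧ norm2 x z < r := by
  obtain ⟨K, -, hK⟩ := exists_rightInverse_of_rank P.A hA
  obtain ⟨x, hx, -⟩ := hK u
  obtain ⟨r', ⟨x, y, z, h1, h2, rfl⟩, hr⟩ := exists_lt_of_csInf_lt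
    (⟨_, x, 0, v + P.Q *ᵥ x, hx, by simp, rfl⟩ : Set.Nonempty {r : ℝ | ∃ (x : Fin n → ℝ)
      (y : Fin m → ℝ) (z : Fin n → ℝ),
      P.A *ᵥ x = u ∧ -(P.Q *ᵥ x) + P.Aᵀ *ᵥ y + z = v ∧ r = norm2 x z}) h
  exact ⟨x, y, z, h1, h2, hr⟩

lemma normA_add_smul_le (hA : P.A.rank = m) (u u' : Fin m → ℝ) (v v' : Fin n → ℝ) {a t : ℝ}
    (ha : 0 ≤ a) (ht : 0 ≤ t) :
    normA P (a • u + t • u') (a • v + t • v') ≤ a * normA P u v + t * normA P u' v' := by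
  have key : ∀ ε : ℝ, 0 < ε → normA P (a • u + t • u') (a • v + t • v')
      ≤ a * (normA P u v + ε) + t * (normA P u' v' + ε) := by
    intro ε hε
    obtain ⟨x, y, z, h1, h2, h3⟩ := exists_norm2_lt_of_normA_lt hA (lt_add_of_pos_right (normA P u v) hε)
    obtain ⟨x', y', z', h1', h2', h3'⟩ :=
      exists_norm2_lt_of_normA_lt hA (lt_add_of_pos_right (normA P u' v') hε)
    have hle : normA P (a • u + t • u') (a • v + t • v') ≤ norm2 (a • x + t • x') (a • z + t • z') := by
      apply normA_le_norm2 (y := a • y + t • y')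
      · simp only [mulVec_add, mulVec_smul, h1, h1']
      · rw [← h2, ← h2']; simp only [mulVec_add, mulVec_smul]; module
    refine hle.trans ((norm2_add_smul_le x x' z z' ha ht).trans ?_)
    gcongr
  refine le_of_forall_pos_le_add fun ε hε => ?_
  -- The `+ 1` keeps the denominator positive when `a = t = 0`.
  have := key (ε / (a + t + 1)) (by positivity)
  have h2 : (a + t) * (ε / (a + t + 1)) ≤ ε := by
    rw [mul_div_assoc', div_le_iff₀ (by positivity)]; nlinarith
  linarith

lemma normA_zero_le : normA P (0 : Fin m → ℝ) (0 : Fin n → ℝ) ≤ 0 := by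
  rw [← norm2_zero (p := n) (q := n)]
  exact normA_le_norm2 (y := 0) (by simp) (by simp)

lemma normA_smul_le (hA : P.A.rank = m) (u : Fin m → ℝ) (v : Fin n → ℝ) {a : ℝ} (ha : 0 ≤ a) :
    normA P (a • u) (a • v) ≤ a * normA P u v := by
  simpa using normA_add_smul_le hA u 0 v 0 ha le_rfl

lemma exists_normA_le (hA : P.A.rank = m) :
    ∃ K, 0 ≤ K ∧ ∀ (u : Fin m → ℝ) (v : Fin n → ℝ), normA P u v ≤ K * (‖u‖ + ‖v‖) := by
  obtain ⟨K, hK0, hK⟩ := exists_rightInverse_of_rank P.A hA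
  obtain ⟨L, hL0, hL⟩ := exists_norm_mulVec_le P.Q
  refine ⟨(n + n) * (K + 1 + L * K), by positivity, fun u v => ?_⟩
  obtain ⟨x, hx, hxn⟩ := hK u
  refine (normA_le_norm2 (x := x) (y := 0) (z := v + P.Q *ᵥ x) hx (by simp)).trans
    ((norm2_le_sum _ _).trans ?_)
  rw [mul_assoc]
  gcongr
  have h1 : ‖v + P.Q *ᵥ x‖ ≤ ‖v‖ + L * (K * ‖u‖) :=
    (norm_add_le _ _).trans (by gcongr; exact (hL x).trans (by gcongr))
  have : 0 ≤ (K + L * K) * ‖v‖ := by positivity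
  nlinarith [norm_nonneg u]

end NormA

variable {m n : ℕ} {P : QP m n} {par : Params} {y₀ : Fin m → ℝ}

/-! ### KKT points are optimal -/

section Optimality

/-- With `d = x' - x`, the primal gap to a feasible `x'` is `zᵀx' + ½ dᵀQd`, and the dual gap to a
feasible `(x', y', z')` is `z'ᵀx + ½ dᵀQd`. Both are nonnegative. -/
lemma IsKKT.isPrimalDualSolution (hQ : P.Q.PosSemidef) {x : Fin n → ℝ} {y : Fin m → ℝ}
    {z : Fin n → ℝ} (h : IsKKT P x y z) : IsPrimalDualSolution P x y z := by
  obtain ⟨hd, hp, hc, hx, hz⟩ := h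
  have hd' : P.c = -(P.Q *ᵥ x) + P.Aᵀ *ᵥ y + z := by
    rw [← sub_eq_zero, ← hd]; abel
  have hp' : P.A *ᵥ x = P.b := sub_eq_zero.1 hp
  have hxz : x ⬝ᵥ z = 0 := Finset.sum_eq_zero fun i _ => hc i
  have hquad : ∀ u v : Fin n → ℝ,
      0 ≤ u ⬝ᵥ (P.Q *ᵥ u) + v ⬝ᵥ (P.Q *ᵥ v) - 2 * (u ⬝ᵥ (P.Q *ᵥ v)) := by
    intro u v
    have h1 := hQ.dotProduct_mulVec_nonneg (u - v)
    have h2 : v ⬝ᵥ (P.Q *ᵥ u) = u ⬝ᵥ (P.Q *ᵥ v) := by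
      have hT : P.Qᵀ = P.Q := by simpa [IsSymm] using hQ.1
      rw [dotProduct_mulVec, ← mulVec_transpose, hT, dotProduct_comm]
    simp only [star_trivial, mulVec_sub, dotProduct_sub, sub_dotProduct] at h1
    linarith
  have hadj : ∀ (u : Fin n → ℝ) (w : Fin m → ℝ), (P.Aᵀ *ᵥ w) ⬝ᵥ u = (P.A *ᵥ u) ⬝ᵥ w := by
    intro u w
    rw [mulVec_transpose, ← dotProduct_mulVec, dotProduct_comm]
  refine ⟨⟨hd, hp, hc, hx, hz⟩, ⟨⟨hp', hx⟩, ?_⟩, ⟨hd'.symm, hz⟩, ?_⟩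
  · rintro x' ⟨hp2, hx2⟩
    have hz2 : 0 ≤ z ⬝ᵥ x' := Finset.sum_nonneg fun i _ => mul_nonneg (hz i) (hx2 i)
    have hq := hquad x' x
    rw [dotProduct_comm] at hxz
    have e1 := dotProduct_comm x' (P.Q *ᵥ x)
    have e2 := dotProduct_comm x (P.Q *ᵥ x)
    simp only [primalObj, hd', add_dotProduct, neg_dotProduct, hadj, hp2, hp']
    linarith
  · rintro x' y' z' ⟨hd2, hz2⟩
    have hz3 : 0 ≤ z' ⬝ᵥ x := Finset.sum_nonneg fun i _ => mul_nonneg (hz2 i) (hx i)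
    have hq := hquad x x'
    rw [dotProduct_comm] at hxz
    -- Expanding `cᵀx` by each of the two dual equations gives the identity that links `bᵀy'` and
    -- `bᵀy`.
    have key : P.c ⬝ᵥ x = P.c ⬝ᵥ x := rfl
    conv_lhs at key => rw [← hd2]
    conv_rhs at key => rw [hd']
    have e1 := dotProduct_comm x (P.Q *ᵥ x')
    have e2 := dotProduct_comm x (P.Q *ᵥ x)
    simp only [add_dotProduct, neg_dotProduct, hadj, hp'] at key
    simp only [dualObj]
    linarith

end Optimality

/-! ### Boundedness of points in a neighbourhood -/

section Energy

/-- Let `(u, w, v)` be the difference between `(x, y, z)` and the mixture `(1 - θ)(xs, ys, zs) +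
θ(x₀ + xt, y₀ + yt, z₀ + zt)`. In the equations for `(u, w, v)` all residuals cancel except the
proximal terms, so `uᵀv` is bounded below through `uᵀQu ≥ 0`. Expanding `uᵀv` entrywise bounds it
above. -/
lemma perturbed_residual_sum_le (hQ : P.Q.PosSemidef) {xs zs x z ζ xt zt : Fin n → ℝ}
    {ys y η yt : Fin m → ℝ} (hs : IsKKT P xs ys zs) {μ θ r : ℝ} (hθ0 : 0 ≤ θ) (hθ1 : θ ≤ 1)
    (hxt : ‖xt‖ ≤ r) (hzt : ‖zt‖ ≤ r) (hr : r < par.ρ) (hx : ∀ i, 0 < x i) (hz : ∀ i, 0 < z i)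
    (hp : P.A *ᵥ x + μ • (y - η) = P.b + θ • (bbar P par + P.A *ᵥ xt))
    (hd : -(P.Q *ᵥ x) + P.Aᵀ *ᵥ y + z - μ • (x - ζ)
      = P.c + θ • (cbar P par y₀ + (-(P.Q *ᵥ xt) + P.Aᵀ *ᵥ yt + zt))) :
    θ * (par.ρ - r) * (∑ i, x i + ∑ i, z i) ≤
      x ⬝ᵥ z + θ * (2 * par.ρ * (∑ i, xs i + ∑ i, zs i) + 4 * par.ρ ^ 2 * n)
      - μ * ((x - ((1 - θ) • xs + θ • ((fun _ => par.ρ) + xt))) ⬝ᵥ (x - ζ)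
        + (y - ((1 - θ) • ys + θ • (y₀ + yt))) ⬝ᵥ (y - η)) := by
  obtain ⟨hsd, hsp, hsc, hsx, hsz⟩ := hs
  set u := x - ((1 - θ) • xs + θ • ((fun _ => par.ρ) + xt)) with hu
  set w := y - ((1 - θ) • ys + θ • (y₀ + yt)) with hw
  set v := z - ((1 - θ) • zs + θ • ((fun _ => par.ρ) + zt)) with hv
  have hb : P.b = P.A *ᵥ xs := (sub_eq_zero.1 hsp).symm
  have hc : P.c = -(P.Q *ᵥ xs) + P.Aᵀ *ᵥ ys + zs := by
    rw [← sub_eq_zero, ← hsd]; abel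
  have hAu : P.A *ᵥ u = -(μ • (y - η)) := by
    have : P.A *ᵥ x = P.b + θ • (bbar P par + P.A *ᵥ xt) - μ • (y - η) := eq_sub_of_add_eq hp
    simp only [hu, mulVec_sub, mulVec_add, mulVec_smul, this, bbar, hb]
    module
  have hQu : v = P.Q *ᵥ u - P.Aᵀ *ᵥ w + μ • (x - ζ) := by
    have : z = P.c + θ • (cbar P par y₀ + (-(P.Q *ᵥ xt) + P.Aᵀ *ᵥ yt + zt))
        + P.Q *ᵥ x - P.Aᵀ *ᵥ y + μ • (x - ζ) := by
      rw [← hd]; abel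
    rw [hv, this]
    simp only [hu, hw, mulVec_sub, mulVec_add, mulVec_smul, cbar, hc]
    module
  have hadj : u ⬝ᵥ (P.Aᵀ *ᵥ w) = -(μ * (w ⬝ᵥ (y - η))) := by
    rw [dotProduct_comm, mulVec_transpose, ← dotProduct_mulVec, hAu]
    simp
  have hlow : μ * (u ⬝ᵥ (x - ζ) + w ⬝ᵥ (y - η)) ≤ u ⬝ᵥ v := by
    have h1 := hQ.dotProduct_mulVec_nonneg u
    rw [star_trivial] at h1
    rw [hQu, dotProduct_add, dotProduct_sub u (P.Q *ᵥ u), hadj, dotProduct_smul, smul_eq_mul]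
    linarith
  have hup : u ⬝ᵥ v ≤ ∑ i, (x i * z i + θ * (2 * par.ρ * (xs i + zs i) + 4 * par.ρ ^ 2)
      - θ * (par.ρ - r) * (x i + z i)) := by
    refine Finset.sum_le_sum fun i _ => ?_
    have a1 := (abs_le.1 ((norm_le_pi_norm xt i).trans hxt))
    have a2 := (abs_le.1 ((norm_le_pi_norm zt i).trans hzt))
    have hui : u i = x i - ((1 - θ) * xs i + θ * (par.ρ + xt i)) := rfl
    have hvi : v i = z i - ((1 - θ) * zs i + θ * (par.ρ + zt i)) := rfl
    have hρ := par.ρ_pos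
    rw [hui, hvi]
    generalize xt i = p at *
    generalize zt i = q at *
    have c := hsc i
    have hxi := hx i
    have hzi := hz i
    have b1 := hsx i
    have b2 := hsz i
    generalize xs i = a at *
    generalize zs i = b at *
    generalize x i = X at *
    generalize z i = Z at *
    have hθ2 : 0 ≤ 1 - θ := by linarith
    have l1 : θ * (par.ρ - r) * X ≤ X * ((1 - θ) * b + θ * (par.ρ + q)) := by
      have : θ * (par.ρ - r) ≤ θ * (par.ρ + q) := by gcongr; linarith
      nlinarith [mul_nonneg hθ2 b2]
    have l2 : θ * (par.ρ - r) * Z ≤ Z * ((1 - θ) * a + θ * (par.ρ + p)) := by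
      have : θ * (par.ρ - r) ≤ θ * (par.ρ + p) := by gcongr; linarith
      nlinarith [mul_nonneg hθ2 b1]
    -- Complementarity of the KKT point removes the only term without a factor `θ`. This is what
    -- allows division by `θ` later.
    have l3 : ((1 - θ) * a + θ * (par.ρ + p)) * ((1 - θ) * b + θ * (par.ρ + q))
        ≤ θ * (2 * par.ρ * (a + b) + 4 * par.ρ ^ 2) := by
      have e : ((1 - θ) * a + θ * (par.ρ + p)) * ((1 - θ) * b + θ * (par.ρ + q))
          = (1 - θ) ^ 2 * (a * b) + θ * ((1 - θ) * (a * (par.ρ + q) + (par.ρ + p) * b)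
            + θ * ((par.ρ + p) * (par.ρ + q))) := by ring
      rw [e, c, mul_zero, zero_add]
      refine mul_le_mul_of_nonneg_left ?_ hθ0
      have k1 : a * (par.ρ + q) + (par.ρ + p) * b ≤ 2 * par.ρ * (a + b) := by
        nlinarith [mul_nonneg b1 (by linarith : 0 ≤ par.ρ - q),
          mul_nonneg b2 (by linarith : 0 ≤ par.ρ - p)]
      have k2 : (par.ρ + p) * (par.ρ + q) ≤ 4 * par.ρ ^ 2 := by
        have : (par.ρ + p) * (par.ρ + q) ≤ (2 * par.ρ) * (2 * par.ρ) :=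
          mul_le_mul (by linarith) (by linarith) (by linarith) (by linarith)
        linarith
      have k3 : 0 ≤ 2 * par.ρ * (a + b) := by positivity
      have k4 : 0 ≤ 4 * par.ρ ^ 2 := by positivity
      nlinarith [mul_le_mul_of_nonneg_left k1 hθ2, mul_le_mul_of_nonneg_left k2 hθ0,
        mul_nonneg hθ0 k3, mul_nonneg hθ2 k4]
    linarith
  have hsum : ∑ i, (x i * z i + θ * (2 * par.ρ * (xs i + zs i) + 4 * par.ρ ^ 2)
      - θ * (par.ρ - r) * (x i + z i)) = x ⬝ᵥ z
      + θ * (2 * par.ρ * (∑ i, xs i + ∑ i, zs i) + 4 * par.ρ ^ 2 * n)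
      - θ * (par.ρ - r) * (∑ i, x i + ∑ i, z i) := by
    rw [Finset.sum_sub_distrib, Finset.sum_add_distrib, ← Finset.mul_sum, ← Finset.mul_sum,
      Finset.sum_add_distrib, Finset.sum_add_distrib, ← Finset.mul_sum, Finset.sum_add_distrib]
    simp only [dotProduct, Finset.sum_const, Finset.card_univ, Fintype.card_fin, nsmul_eq_mul]
    ring
  linarith

lemma norm_le_sum {x : Fin n → ℝ} (hx : ∀ i, 0 < x i) : ‖x‖ ≤ ∑ i, x i := by
  refine (pi_norm_le_iff_of_nonneg (Finset.sum_nonneg fun i _ => (hx i).le)).2 fun i => ?_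
  rw [Real.norm_of_nonneg (hx i).le]
  exact Finset.single_le_sum (fun i _ => (hx i).le) (Finset.mem_univ i)

/-- With `p = x - a` and `q = ζ - a`, this is `p·(p - q) ≥ -q·q`. The bound does not involve the
size of `x`. -/
lemma neg_sq_le_dotProduct_sub {p : ℕ} (x a ζ : Fin p → ℝ) {X D : ℝ} (ha : ‖a‖ ≤ X)
    (hζ : ‖ζ‖ ≤ D) : -(p * (D + X) ^ 2) ≤ (x - a) ⬝ᵥ (x - ζ) := by
  have h1 : 0 ≤ (x - a) ⬝ᵥ (x - ζ) + (ζ - a) ⬝ᵥ (ζ - a) := by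
    rw [dotProduct, dotProduct, ← Finset.sum_add_distrib]
    refine Finset.sum_nonneg fun i _ => ?_
    simp only [Pi.sub_apply]
    nlinarith [sq_nonneg (x i - a i - (ζ i - a i)), sq_nonneg (x i - a i), sq_nonneg (ζ i - a i)]
  have h2 := le_of_abs_le (abs_dotProduct_le (ζ - a) (ζ - a))
  have h3 : ‖ζ - a‖ ≤ D + X := (norm_sub_le _ _).trans (by gcongr)
  have h4 : (p : ℝ) * (‖ζ - a‖ * ‖ζ - a‖) ≤ p * (D + X) ^ 2 := by
    rw [sq]
    have := (norm_nonneg _).trans h3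
    gcongr
  linarith

lemma mu0_eq (hn : 0 < n) : mu0 n par = par.ρ ^ 2 := by
  have : (n : ℝ) ≠ 0 := by positivity
  simp [mu0, mu, dotProduct]
  field_simp

/-- Points of a neighbourhood whose proximal estimates are the point itself, or are bounded, are
bounded. -/
lemma exists_bound_of_inNbhd (hn : 0 < n) (hQ : P.Q.PosSemidef) (hA : P.A.rank = m)
    {xs zs : Fin n → ℝ} {ys : Fin m → ℝ} (hs : IsKKT P xs ys zs) (par : Params) (y₀ : Fin m → ℝ)
    (D : ℝ) : ∃ R, ∀ (x z ζ : Fin n → ℝ) (y η : Fin m → ℝ), mu x z ≤ mu0 n par →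
      InNbhd P par y₀ (mu x z) ζ η x y z → (ζ = x ∧ η = y ∨ ‖ζ‖ ≤ D ∧ ‖η‖ ≤ D) →
      ‖x‖ ≤ R ∧ ‖y‖ ≤ R ∧ ‖z‖ ≤ R := by
  obtain ⟨KA, hKA0, hKA⟩ := exists_norm_le_transpose_mulVec P.A hA
  obtain ⟨KQ, hKQ0, hKQ⟩ := exists_norm_mulVec_le P.Q
  have hρ := par.ρ_pos
  have hCN := par.CN_pos
  have hm0 : 0 < mu0 n par := by rw [mu0_eq hn]; positivity
  have hn' : (0 : ℝ) < n := by exact_mod_cast hn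
  obtain ⟨X, hXdef⟩ : ∃ X, X = ‖xs‖ + (par.ρ + par.ρ) := ⟨_, rfl⟩
  obtain ⟨Y, hY⟩ : ∃ Y, Y = ‖ys‖ + (‖y₀‖ + KA * (par.CN + KQ * par.ρ + par.ρ)) := ⟨_, rfl⟩
  -- The midpoint between `γA ρ` and `ρ`: above the first, so that a representative of norm below
  -- `r` exists, and below the second, so that `ρ - r > 0`.
  obtain ⟨r, hr⟩ : ∃ r, r = (1 + par.γA) / 2 * par.ρ := ⟨_, rfl⟩
  have hrρ : r < par.ρ := by have := par.γA_lt; rw [hr]; nlinarith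
  have hγr : par.γA * par.ρ < r := by have := par.γA_lt; rw [hr]; nlinarith
  obtain ⟨E, hE⟩ : ∃ E, E = mu0 n par * (n + n * (D + X) ^ 2 + m * (D + Y) ^ 2)
    + (2 * par.ρ * (∑ i, xs i + ∑ i, zs i) + 4 * par.ρ ^ 2 * n) := ⟨_, rfl⟩
  obtain ⟨S, hS⟩ : ∃ S, S = E / (par.ρ - r) := ⟨_, rfl⟩
  obtain ⟨R, hR⟩ : ∃ R, R = S + KA * (‖P.c‖ + (‖cbar P par y₀‖ + par.CN) + KQ * S + S
    + mu0 n par * (S + |D|)) := ⟨_, rfl⟩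
  have hsum_nonneg : 0 ≤ ∑ i, xs i + ∑ i, zs i :=
    add_nonneg (Finset.sum_nonneg fun i _ => hs.2.2.2.1 i)
      (Finset.sum_nonneg fun i _ => hs.2.2.2.2 i)
  have hE0 : 0 ≤ E := by rw [hE]; positivity
  have hS0 : 0 ≤ S := hS ▸ div_nonneg hE0 (by linarith)
  refine ⟨R, fun x z ζ y η hμ0 hN hcase => ?_⟩
  obtain ⟨⟨bt, ct, hp, hd, h2, hA2⟩, hx, hz, hxz⟩ := hN
  obtain ⟨xt, yt, zt, e1, e2, h3⟩ :=
    exists_norm2_lt_of_normA_lt hA (hA2.trans_lt hγr)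
  have hμpos : 0 < mu x z := by
    have : Nonempty (Fin n) := ⟨⟨0, hn⟩⟩
    exact div_pos (Finset.sum_pos (fun i _ => mul_pos (hx i) (hz i)) Finset.univ_nonempty) hn'
  have hxzμ : x ⬝ᵥ z = n * mu x z := by rw [mu]; field_simp
  set μ := mu x z with hμ
  set θ := μ / mu0 n par with hθ
  have hθ0 : 0 < θ := div_pos hμpos hm0
  have hθ1 : θ ≤ 1 := (div_le_one hm0).2 hμ0
  have hμθ : μ = θ * mu0 n par := by rw [hθ]; field_simp
  have hxt : ‖xt‖ ≤ r := (norm_left_le_norm2 xt zt).trans h3.le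
  have hzt : ‖zt‖ ≤ r := (norm_right_le_norm2 xt zt).trans h3.le
  have hct : ‖ct‖ ≤ par.CN := (norm_right_le_norm2 bt ct).trans h2
  have hyt : ‖yt‖ ≤ KA * (par.CN + KQ * par.ρ + par.ρ) := by
    refine (hKA yt).trans (mul_le_mul_of_nonneg_left ?_ hKA0)
    have : P.Aᵀ *ᵥ yt = ct + P.Q *ᵥ xt - zt := by rw [← e2]; abel
    rw [this]
    refine (norm_sub_le _ _).trans (add_le_add ((norm_add_le _ _).trans (add_le_add hct ?_))
      (hzt.trans hrρ.le))
    exact (hKQ xt).trans (mul_le_mul_of_nonneg_left (hxt.trans hrρ.le) hKQ0)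
  have hconv : ∀ {p : ℕ} (a b : Fin p → ℝ), ‖(1 - θ) • a + θ • b‖ ≤ ‖a‖ + ‖b‖ := by
    intro p a b
    refine (norm_add_le _ _).trans ?_
    rw [norm_smul, norm_smul, Real.norm_of_nonneg hθ0.le, Real.norm_of_nonneg (by linarith)]
    nlinarith [norm_nonneg a, norm_nonneg b]
  have hX : ‖(1 - θ) • xs + θ • ((fun _ => par.ρ) + xt)‖ ≤ X := by
    rw [hXdef]
    refine (hconv _ _).trans (add_le_add le_rfl ((norm_add_le _ _).trans
      (add_le_add ?_ (hxt.trans hrρ.le))))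
    exact (pi_norm_le_iff_of_nonneg hρ.le).2 fun i => by simp [abs_of_pos hρ]
  have hYb : ‖(1 - θ) • ys + θ • (y₀ + yt)‖ ≤ Y :=
    hY ▸ (hconv _ _).trans (add_le_add le_rfl ((norm_add_le _ _).trans (add_le_add le_rfl hyt)))
  have hsum := perturbed_residual_sum_le (par := par) (y₀ := y₀) (yt := yt) hQ hs hθ0.le hθ1 hxt hzt
    hrρ hx hz (by rw [e1]; exact hp) (by rw [e2]; exact hd)
  have hprox : -(n * (D + X) ^ 2 + m * (D + Y) ^ 2) ≤
      (x - ((1 - θ) • xs + θ • ((fun _ => par.ρ) + xt))) ⬝ᵥ (x - ζ)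
        + (y - ((1 - θ) • ys + θ • (y₀ + yt))) ⬝ᵥ (y - η) := by
    rcases hcase with ⟨rfl, rfl⟩ | ⟨hζ, hη⟩
    · simp only [sub_self, dotProduct_zero, add_zero]
      have : (0 : ℝ) ≤ n * (D + X) ^ 2 + m * (D + Y) ^ 2 := by positivity
      linarith
    · linarith [neg_sq_le_dotProduct_sub x _ ζ hX hζ, neg_sq_le_dotProduct_sub y _ η hYb hη]
  have hsumS : ∑ i, x i + ∑ i, z i ≤ S := by
    rw [hS, le_div_iff₀ (by linarith)]
    have h5 := mul_le_mul_of_nonneg_left hprox hμpos.le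
    -- Every term on the right carries a factor `θ`, because `μ = θ μ₀`. Cancelling it leaves a
    -- bound independent of `μ`.
    have h6 : θ * ((∑ i, x i + ∑ i, z i) * (par.ρ - r)) ≤ θ * E := by
      rw [hxzμ] at hsum
      rw [hE]
      rw [hμθ] at hsum h5
      linarith
    exact le_of_mul_le_mul_left h6 hθ0
  have hxS : ‖x‖ ≤ S := by
    linarith [norm_le_sum hx, Finset.sum_nonneg fun i (_ : i ∈ Finset.univ) => (hz i).le]
  have hzS : ‖z‖ ≤ S := by
    linarith [norm_le_sum hz, Finset.sum_nonneg fun i (_ : i ∈ Finset.univ) => (hx i).le]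
  have hSR : S ≤ R := by
    rw [hR]; exact le_add_of_nonneg_right (by positivity)
  refine ⟨hxS.trans hSR, ?_, hzS.trans hSR⟩
  -- The dual equation determines `Aᵀy`, and full row rank recovers `y` from it.
  have hy : ‖y‖ ≤ KA * (‖P.c‖ + (‖cbar P par y₀‖ + par.CN) + KQ * S + S
      + mu0 n par * (S + |D|)) := by
    refine (hKA y).trans (mul_le_mul_of_nonneg_left ?_ hKA0)
    have : P.Aᵀ *ᵥ y = P.c + θ • (cbar P par y₀ + ct) + P.Q *ᵥ x - z + μ • (x - ζ) := by
      rw [← hd]; abel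
    rw [this]
    refine (norm_add_le _ _).trans (add_le_add ((norm_sub_le _ _).trans (add_le_add
      ((norm_add_le _ _).trans (add_le_add ((norm_add_le _ _).trans
      (add_le_add le_rfl ?_)) ?_)) hzS)) ?_)
    · rw [norm_smul, Real.norm_of_nonneg hθ0.le]
      refine (mul_le_of_le_one_left (norm_nonneg _) hθ1).trans
        ((norm_add_le _ _).trans (add_le_add le_rfl hct))
    · exact (hKQ x).trans (mul_le_mul_of_nonneg_left hxS hKQ0)
    · rw [norm_smul, Real.norm_of_nonneg hμpos.le]
      refine mul_le_mul hμ0 ?_ (norm_nonneg _) hm0.le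
      rcases hcase with ⟨rfl, rfl⟩ | ⟨hζ, hη⟩
      · simp only [sub_self, norm_zero]; positivity
      · exact (norm_sub_le _ _).trans (add_le_add hxS (hζ.trans (le_abs_self D)))
  rw [hR]; linarith

end Energy

/-! ### Newton directions and a uniform step-length while `μ` stays away from zero -/

/-- The state `s` lies in its own neighbourhood, all its components are bounded by `R`, and its
complementarity measure is between `μs` and the initial one. -/
structure IsBoundedState (P : QP m n) (par : Params) (y₀ : Fin m → ℝ) (R μs : ℝ)
    (s : State m n) : Prop where
  nbhd : InNbhd P par y₀ (mu s.x s.z) s.ζ s.η s.x s.y s.z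
  le_mu : μs ≤ mu s.x s.z
  mu_le : mu s.x s.z ≤ mu0 n par
  x_le : ‖s.x‖ ≤ R
  y_le : ‖s.y‖ ≤ R
  z_le : ‖s.z‖ ≤ R
  ζ_le : ‖s.ζ‖ ≤ R
  η_le : ‖s.η‖ ≤ R

/-- Eliminating `dz` leaves a system whose quadratic form dominates `μ(‖dx‖² + ‖dy‖²)`, by the
proximal terms alone. The right-hand side is linear in the direction with bounded coefficients. -/
lemma exists_newtonDir_bound (hn : 0 < n) (hQ : P.Q.PosSemidef) (par : Params) (y₀ : Fin m → ℝ)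
    {R μs : ℝ} (hR : 0 < R) (hμs : 0 < μs) : ∃ M, 0 ≤ M ∧ ∀ (s : State m n) (σ : ℝ)
      (dx : Fin n → ℝ) (dy : Fin m → ℝ) (dz : Fin n → ℝ), IsBoundedState P par y₀ R μs s →
      0 ≤ σ → σ ≤ 1 → IsNewtonDir P par y₀ s σ dx dy dz → ‖dx‖ ≤ M ∧ ‖dy‖ ≤ M ∧ ‖dz‖ ≤ M := by
  obtain ⟨KA, hKA0, hKA⟩ := exists_norm_mulVec_le P.A
  obtain ⟨KT, hKT0, hKT⟩ := exists_norm_mulVec_le P.Aᵀ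
  obtain ⟨KQ, hKQ0, hKQ⟩ := exists_norm_mulVec_le P.Q
  have hγ := par.γμ_pos
  have hρ := par.ρ_pos
  have hm0 : 0 < mu0 n par := by rw [mu0_eq hn]; positivity
  obtain ⟨Bp, hBp⟩ : ∃ B, B = KA * R + mu0 n par * (R + R) + (‖P.b‖ + ‖bbar P par‖) := ⟨_, rfl⟩
  obtain ⟨Bd, hBd⟩ : ∃ B, B = ‖P.c‖ + ‖cbar P par y₀‖ + KQ * R + KT * R + R
    + mu0 n par * (R + R) := ⟨_, rfl⟩
  -- `σμ / x_i ≤ z_i / γμ ≤ R / γμ`, by the lower bound on the products `x_i z_i`.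
  obtain ⟨Bw, hBw⟩ : ∃ B, B = R + R / par.γμ := ⟨_, rfl⟩
  have hBp0 : 0 ≤ Bp := by rw [hBp]; positivity
  have hBd0 : 0 ≤ Bd := by rw [hBd]; positivity
  have hBw0 : 0 ≤ Bw := by rw [hBw]; positivity
  obtain ⟨T, hT⟩ : ∃ T, T = (m * Bp + n * Bw + n * Bd) / μs := ⟨_, rfl⟩
  have hT0 : 0 ≤ T := by rw [hT]; positivity
  have hTz : 0 ≤ Bw + R * R / (par.γμ * μs) * T := by positivity
  refine ⟨T + (Bw + R * R / (par.γμ * μs) * T), by positivity,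
    fun s σ dx dy dz hs hσ0 hσ1 hN => ?_⟩
  obtain ⟨h1, h2, h3⟩ := hN
  obtain ⟨-, hx, hz, hxz⟩ := hs.nbhd
  have hμ1 := hs.le_mu
  have hμ2 := hs.mu_le
  set μ := mu s.x s.z
  have hμ : 0 < μ := hμs.trans_le hμ1
  have hσμ0 : 0 ≤ σ * μ := by positivity
  have hσμ1 : σ * μ ≤ mu0 n par := (mul_le_of_le_one_left hμ.le hσ1).trans hμ2
  have hσθ0 : 0 ≤ σ * μ / mu0 n par := by positivity
  have hσθ1 : σ * μ / mu0 n par ≤ 1 := (div_le_one hm0).2 hσμ1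
  obtain ⟨rp, hrp⟩ : ∃ r, r = -(P.A *ᵥ s.x + (σ * μ) • (s.y - s.η)
    - (P.b + (σ * μ / mu0 n par) • bbar P par)) := ⟨_, rfl⟩
  obtain ⟨rd, hrd⟩ : ∃ r, r = -(-(P.c + (σ * μ / mu0 n par) • cbar P par y₀) - P.Q *ᵥ s.x
    + P.Aᵀ *ᵥ s.y + s.z - (σ * μ) • (s.x - s.ζ)) := ⟨_, rfl⟩
  have hsub : ∀ {p : ℕ} (a b : Fin p → ℝ), ‖a‖ ≤ R → ‖b‖ ≤ R →
      ‖(σ * μ) • (a - b)‖ ≤ mu0 n par * (R + R) := by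
    intro p a b ha hb
    rw [norm_smul, Real.norm_of_nonneg hσμ0]
    exact mul_le_mul hσμ1 ((norm_sub_le _ _).trans (add_le_add ha hb)) (norm_nonneg _) hm0.le
  have hθs : ∀ {p : ℕ} (a : Fin p → ℝ), ‖(σ * μ / mu0 n par) • a‖ ≤ ‖a‖ := by
    intro p a
    rw [norm_smul, Real.norm_of_nonneg hσθ0]
    exact mul_le_of_le_one_left (norm_nonneg _) hσθ1
  have hrpB : ‖rp‖ ≤ Bp := by
    rw [hrp, hBp, norm_neg]
    refine (norm_sub_le _ _).trans (add_le_add ((norm_add_le _ _).trans (add_le_add ?_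
      (hsub _ _ hs.y_le hs.η_le))) ((norm_add_le _ _).trans (add_le_add le_rfl (hθs _))))
    exact (hKA _).trans (mul_le_mul_of_nonneg_left hs.x_le hKA0)
  have hrdB : ‖rd‖ ≤ Bd := by
    rw [hrd, hBd, norm_neg]
    refine (norm_sub_le _ _).trans (add_le_add ((norm_add_le _ _).trans (add_le_add
      ((norm_add_le _ _).trans (add_le_add ((norm_sub_le _ _).trans (add_le_add ?_ ?_)) ?_))
      hs.z_le)) (hsub _ _ hs.x_le hs.ζ_le))
    · rw [norm_neg]
      exact (norm_add_le _ _).trans (add_le_add le_rfl (hθs _))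
    · exact (hKQ _).trans (mul_le_mul_of_nonneg_left hs.x_le hKQ0)
    · exact (hKT _).trans (mul_le_mul_of_nonneg_left hs.y_le hKT0)
  rw [← hrp] at h2
  rw [← hrd] at h1
  have hxR : ∀ i, s.x i ≤ R := fun i => (le_abs_self _).trans ((norm_le_pi_norm s.x i).trans hs.x_le)
  have hzR : ∀ i, s.z i ≤ R := fun i => (le_abs_self _).trans ((norm_le_pi_norm s.z i).trans hs.z_le)
  obtain ⟨w, hw⟩ : ∃ w : Fin n → ℝ, ∀ i, w i = -s.z i + σ * μ / s.x i := ⟨fun i => _, fun i => rfl⟩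
  have hwB : ‖w‖ ≤ Bw := by
    refine (pi_norm_le_iff_of_nonneg hBw0).2 fun i => ?_
    rw [hw, hBw]
    refine (norm_add_le _ _).trans (add_le_add ?_ ?_)
    · rw [norm_neg, Real.norm_of_nonneg (hz i).le]; exact hzR i
    · rw [Real.norm_of_nonneg (div_nonneg hσμ0 (hx i).le), div_le_div_iff₀ (hx i) hγ]
      nlinarith [hxz i, mul_le_mul_of_nonneg_right (hzR i) (hx i).le, mul_le_of_le_one_left hμ.le hσ1]
  have hdz : ∀ i, dz i = w i - s.z i / s.x i * dx i := by
    intro i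
    have := h3 i
    have hxi := (hx i).ne'
    rw [hw]
    field_simp
    linarith
  -- The discarded term is `-∑ (z_i / x_i) dx_i²`.
  have hdxw : dx ⬝ᵥ dz ≤ dx ⬝ᵥ w := by
    refine Finset.sum_le_sum fun i _ => ?_
    rw [hdz]
    have : 0 ≤ s.z i / s.x i * (dx i * dx i) :=
      mul_nonneg (div_nonneg (hz i).le (hx i).le) (mul_self_nonneg _)
    linarith
  have henergy : μ * (dx ⬝ᵥ dx + dy ⬝ᵥ dy) ≤ rp ⬝ᵥ dy + dx ⬝ᵥ w - dx ⬝ᵥ rd := by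
    have hq := hQ.dotProduct_mulVec_nonneg dx
    rw [star_trivial] at hq
    have e1 : dx ⬝ᵥ (P.Aᵀ *ᵥ dy) = rp ⬝ᵥ dy - μ * (dy ⬝ᵥ dy) := by
      rw [dotProduct_comm, mulVec_transpose, ← dotProduct_mulVec, eq_sub_of_add_eq h2,
        dotProduct_sub, dotProduct_smul, smul_eq_mul, dotProduct_comm]
    have e2 : dx ⬝ᵥ rd = -(dx ⬝ᵥ (P.Q *ᵥ dx) + μ * (dx ⬝ᵥ dx)) + dx ⬝ᵥ (P.Aᵀ *ᵥ dy)
        + dx ⬝ᵥ dz := by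
      rw [← h1, dotProduct_add, dotProduct_add, dotProduct_neg, add_mulVec, smul_mulVec,
        one_mulVec, dotProduct_add, dotProduct_smul, smul_eq_mul]
    linarith
  have hTb : max ‖dx‖ ‖dy‖ ≤ T := by
    set t := max ‖dx‖ ‖dy‖ with ht
    have ht0 : 0 ≤ t := (norm_nonneg dx).trans (le_max_left _ _)
    have k1 : t ^ 2 ≤ dx ⬝ᵥ dx + dy ⬝ᵥ dy := by
      have a1 := sq_norm_le_dotProduct dx
      have a2 := sq_norm_le_dotProduct dy
      rcases max_choice ‖dx‖ ‖dy‖ with h | h <;> rw [ht, h] <;>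
        nlinarith [sq_nonneg ‖dx‖, sq_nonneg ‖dy‖]
    have b1 : rp ⬝ᵥ dy ≤ m * (Bp * t) := (le_of_abs_le (abs_dotProduct_le _ _)).trans
      (by gcongr; exact le_max_right _ _)
    have b2 : dx ⬝ᵥ w ≤ n * (t * Bw) := (le_of_abs_le (abs_dotProduct_le _ _)).trans
      (by gcongr; exact le_max_left _ _)
    have b3 : -(dx ⬝ᵥ rd) ≤ n * (t * Bd) := (neg_le_of_neg_le (neg_le_of_abs_le
      (abs_dotProduct_le _ _))).trans (by gcongr; exact le_max_left _ _)
    have k2 : μs * t ^ 2 ≤ μ * (dx ⬝ᵥ dx + dy ⬝ᵥ dy) :=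
      mul_le_mul hμ1 k1 (sq_nonneg _) hμ.le
    rw [hT, le_div_iff₀ hμs]
    rcases ht0.eq_or_lt with h0 | h0
    · rw [← h0, zero_mul]; positivity
    · refine le_of_mul_le_mul_right ?_ h0
      linarith
  have hdx : ‖dx‖ ≤ T := (le_max_left _ _).trans hTb
  refine ⟨hdx.trans (by linarith), ((le_max_right _ _).trans hTb).trans (by linarith), ?_⟩
  refine le_trans ((pi_norm_le_iff_of_nonneg hTz).2 fun i => ?_) (le_add_of_nonneg_left hT0)
  rw [hdz]
  refine (norm_sub_le _ _).trans (add_le_add ((norm_le_pi_norm w i).trans hwB) ?_)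
  rw [norm_mul, Real.norm_of_nonneg (div_nonneg (hz i).le (hx i).le)]
  refine mul_le_mul ?_ ((norm_le_pi_norm dx i).trans hdx) (norm_nonneg _) (by positivity)
  rw [div_le_div_iff₀ (hx i) (by positivity)]
  have c1 : par.γμ * μs ≤ s.x i * s.z i := (mul_le_mul_of_nonneg_left hμ1 hγ.le).trans (hxz i)
  calc s.z i * (par.γμ * μs) ≤ R * (s.x i * s.z i) :=
        mul_le_mul (hzR i) c1 (by positivity) hR.le
    _ ≤ R * (s.x i * R) := by gcongr; exacts [(hx i).le, hzR i]
    _ = _ := by ring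

lemma mu_newton_step (hn : 0 < n) {s : State m n} {σ : ℝ} {dx dz : Fin n → ℝ}
    (h : ∀ i, s.z i * dx i + s.x i * dz i = -(s.x i * s.z i - σ * mu s.x s.z)) (a : ℝ) :
    mu (s.x + a • dx) (s.z + a • dz) =
      (1 - a) * mu s.x s.z + a * (σ * mu s.x s.z) + a ^ 2 * (dx ⬝ᵥ dz / n) := by
  have hn' : (n : ℝ) ≠ 0 := by positivity
  have key : (s.x + a • dx) ⬝ᵥ (s.z + a • dz)
      = (1 - a) * (s.x ⬝ᵥ s.z) + n * (a * (σ * mu s.x s.z)) + a ^ 2 * (dx ⬝ᵥ dz) := by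
    have : (n : ℝ) * (a * (σ * mu s.x s.z)) = ∑ _i : Fin n, a * (σ * mu s.x s.z) := by simp
    rw [this, dotProduct, dotProduct, dotProduct, Finset.mul_sum, Finset.mul_sum,
      ← Finset.sum_add_distrib, ← Finset.sum_add_distrib]
    refine Finset.sum_congr rfl fun i _ => ?_
    simp only [Pi.add_apply, Pi.smul_apply, smul_eq_mul]
    linear_combination a * h i
  conv_lhs => rw [mu, key]
  conv_rhs => rw [show (1 - a) * mu s.x s.z = (1 - a) * (s.x ⬝ᵥ s.z / n) from rfl]
  field_simp

/-- The combination `(1 - a)` (old residual equation) `+ a` (Newton equation) matches the new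
equation up to order `a²`. The remainder comes from `a² g` in `μ'` and from the Newton matrix using
`μ` where the new equation has `μ'`. -/
lemma newton_residuals {s : State m n} {σ : ℝ} {dx : Fin n → ℝ} {dy : Fin m → ℝ} {dz : Fin n → ℝ}
    (hN : IsNewtonDir P par y₀ s σ dx dy dz) {bt : Fin m → ℝ} {ct : Fin n → ℝ}
    (hp : P.A *ᵥ s.x + mu s.x s.z • (s.y - s.η)
      = P.b + (mu s.x s.z / mu0 n par) • (bbar P par + bt))
    (hd : -(P.Q *ᵥ s.x) + P.Aᵀ *ᵥ s.y + s.z - mu s.x s.z • (s.x - s.ζ)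
      = P.c + (mu s.x s.z / mu0 n par) • (cbar P par y₀ + ct))
    (hm0 : mu0 n par ≠ 0) {a g μ' : ℝ} (hμ'0 : μ' ≠ 0)
    (hμ' : μ' = (1 - a) * mu s.x s.z + a * (σ * mu s.x s.z) + a ^ 2 * g) :
    P.A *ᵥ (s.x + a • dx) + μ' • (s.y + a • dy - s.η) = P.b + (μ' / mu0 n par) • (bbar P par
      + (((1 - a) * mu s.x s.z / μ') • bt + (a ^ 2 * mu0 n par / μ') •
        (g • (s.y - s.η) + ((σ - 1) * mu s.x s.z + a * g) • dy - (g / mu0 n par) • bbar P par))) ∧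
    -(P.Q *ᵥ (s.x + a • dx)) + P.Aᵀ *ᵥ (s.y + a • dy) + (s.z + a • dz)
      - μ' • (s.x + a • dx - s.ζ) = P.c + (μ' / mu0 n par) • (cbar P par y₀
      + (((1 - a) * mu s.x s.z / μ') • ct + (a ^ 2 * mu0 n par / μ') •
        (-(g • (s.x - s.ζ)) - ((σ - 1) * mu s.x s.z + a * g) • dx
          - (g / mu0 n par) • cbar P par y₀))) := by
  obtain ⟨h1, h2, -⟩ := hN
  generalize mu s.x s.z = μ at *
  generalize mu0 n par = μ0 at *
  constructor
  · ext i
    have e1 := congrFun hp i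
    have e2 := congrFun h2 i
    simp only [mulVec_add, mulVec_smul, Pi.add_apply, Pi.sub_apply, Pi.smul_apply, Pi.neg_apply,
      smul_eq_mul] at e1 e2 ⊢
    have r1 : ∀ B X Y : ℝ, μ' / μ0 * (B + ((1 - a) * μ / μ' * X + a ^ 2 * μ0 / μ' * Y))
        = μ' * (B / μ0) + (1 - a) * μ * (X / μ0) + a ^ 2 * Y := by
      intro B X Y; field_simp; ring
    rw [r1, hμ']
    have r2 : ∀ B X : ℝ, μ / μ0 * (B + X) = μ * (B / μ0) + μ * (X / μ0) := by
      intro B X; field_simp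
    have r3 : ∀ B : ℝ, σ * μ / μ0 * B = σ * μ * (B / μ0) := by intro B; field_simp
    have r4 : ∀ B : ℝ, g / μ0 * B = g * (B / μ0) := by intro B; field_simp
    rw [r2] at e1
    rw [r3] at e2
    rw [r4]
    linear_combination (1 - a) * e1 + a * e2
  · ext i
    have e1 := congrFun hd i
    have e2 := congrFun h1 i
    simp only [mulVec_add, mulVec_smul, add_mulVec, smul_mulVec, one_mulVec, Pi.add_apply,
      Pi.sub_apply, Pi.smul_apply, Pi.neg_apply, smul_eq_mul] at e1 e2 ⊢
    have r1 : ∀ B X Y : ℝ, μ' / μ0 * (B + ((1 - a) * μ / μ' * X + a ^ 2 * μ0 / μ' * Y))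
        = μ' * (B / μ0) + (1 - a) * μ * (X / μ0) + a ^ 2 * Y := by
      intro B X Y; field_simp; ring
    rw [r1, hμ']
    have r2 : ∀ B X : ℝ, μ / μ0 * (B + X) = μ * (B / μ0) + μ * (X / μ0) := by
      intro B X; field_simp
    have r3 : ∀ B : ℝ, σ * μ / μ0 * B = σ * μ * (B / μ0) := by intro B; field_simp
    have r4 : ∀ B : ℝ, g / μ0 * B = g * (B / μ0) := by intro B; field_simp
    rw [r2] at e1
    rw [r3] at e2
    rw [r4]
    linear_combination (1 - a) * e1 + a * e2

lemma eventually_mul_le {c : ℝ} (B : ℝ) (hc : 0 < c) : ∀ᶠ a : ℝ in 𝓝[>] 0, a * B ≤ c := by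
  have h : Tendsto (fun a : ℝ => a * B) (𝓝 0) (𝓝 (0 * B)) :=
    (continuous_id.mul continuous_const).tendsto 0
  rw [zero_mul] at h
  exact (h.mono_left nhdsWithin_le_nhds).eventually (ge_mem_nhds hc)

/-- After multiplication by `μ'`, the terms `(1 - a) μ C` cancel. The centering gain `a σμ C` then
has to absorb the error `a² (μ₀ E + C G)`. -/
lemma damped_combination_le {a μ μ₀ μ' g G E C τ N₁ N₂ : ℝ} (ha0 : 0 < a) (ha1 : a ≤ 1)
    (hμ : 0 < μ) (hμ₀ : 0 < μ₀) (hμ'0 : 0 < μ') (hg : -G ≤ g) {σ : ℝ} (hτ : τ ≤ σ * μ)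
    (hμ' : μ' = (1 - a) * μ + a * (σ * μ) + a ^ 2 * g) (hC : 0 ≤ C) (h1 : N₁ ≤ C) (h2 : N₂ ≤ E)
    (h3 : a * (μ₀ * E + C * G) ≤ C * τ) :
    (1 - a) * μ / μ' * N₁ + a ^ 2 * μ₀ / μ' * N₂ ≤ C := by
  have h1a : 0 ≤ 1 - a := by linarith
  have w1 : 0 ≤ (1 - a) * μ / μ' := by positivity
  have w2 : 0 ≤ a ^ 2 * μ₀ / μ' := by positivity
  refine (add_le_add (mul_le_mul_of_nonneg_left h1 w1) (mul_le_mul_of_nonneg_left h2 w2)).trans ?_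
  have h5 : (1 - a) * μ / μ' * C + a ^ 2 * μ₀ / μ' * E
      = ((1 - a) * μ * C + a ^ 2 * μ₀ * E) / μ' := by field_simp
  rw [h5, div_le_iff₀ hμ'0, hμ']
  have h6 := mul_le_mul_of_nonneg_left h3 ha0.le
  have h8 := mul_le_mul_of_nonneg_left (mul_le_mul_of_nonneg_left hτ hC) ha0.le
  have h9 := mul_le_mul_of_nonneg_left hg (mul_nonneg hC (sq_nonneg a))
  linarith

set_option maxHeartbeats 800000 in
/-- There is a step-length that is admissible at all bounded states. -/
lemma exists_admissible_step (hn : 0 < n) (hQ : P.Q.PosSemidef) (hA : P.A.rank = m)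
    (par : Params) (y₀ : Fin m → ℝ) {R μs : ℝ} (hR : 0 < R) (hμs : 0 < μs) :
    ∃ a, 0 < a ∧ a ≤ 1 ∧ ∀ (s : State m n) (σ : ℝ) (dx : Fin n → ℝ) (dy : Fin m → ℝ)
      (dz : Fin n → ℝ), IsBoundedState P par y₀ R μs s → σ ∈ Set.Icc par.σmin par.σmax →
      IsNewtonDir P par y₀ s σ dx dy dz → a ∈ admissible P par y₀ s dx dy dz := by
  obtain ⟨M, hM0, hM⟩ := exists_newtonDir_bound hn hQ par y₀ hR hμs
  obtain ⟨KN, hKN0, hKN⟩ := exists_normA_le hA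
  have hγ := par.γμ_pos
  have hγ1 := par.γμ_lt
  have hρ := par.ρ_pos
  have hCN := par.CN_pos
  have hγA := par.γA_pos
  have hσm := par.σmin_pos
  have hm0 : 0 < mu0 n par := by rw [mu0_eq hn]; positivity
  have hn' : (0 : ℝ) < n := by exact_mod_cast hn
  obtain ⟨G, hG⟩ : ∃ G, G = M * M := ⟨_, rfl⟩
  have hG0 : 0 ≤ G := by rw [hG]; positivity
  obtain ⟨Ep, hEp⟩ : ∃ E, E = G * (R + R) + (mu0 n par + G) * M
    + G / mu0 n par * (‖bbar P par‖ + ‖cbar P par y₀‖) := ⟨_, rfl⟩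
  have hEp0 : 0 ≤ Ep := by rw [hEp]; positivity
  -- One constant serving both norms: `m + n` comes from `norm2_le_sum`, `KN` from the bound on
  -- `normA`.
  obtain ⟨E, hE⟩ : ∃ E, E = (m + n + KN) * (Ep + Ep) := ⟨_, rfl⟩
  have hE0 : 0 ≤ E := by rw [hE]; positivity
  -- After `0 < a` and `a ≤ 1`, the conditions secure in turn the decrease of `μ` (`0.49 = 1 - 1/2 -
  -- 0.01`, with `σ ≤ 1/2`), the lower bound on the products `x_i z_i`, the two residual norms, and
  -- positivity, since the entries of `x` and `z` are at least `γμ μs / R`.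
  have hev : ∀ᶠ a : ℝ in 𝓝[>] 0, 0 < a ∧ a * 1 ≤ 1 ∧ a * G ≤ 0.49 * μs ∧
      a * (2 * G) ≤ par.σmin * μs * (1 - par.γμ) ∧
      a * (mu0 n par * E + par.CN * G) ≤ par.CN * (par.σmin * μs) ∧
      a * (mu0 n par * E + par.γA * par.ρ * G) ≤ par.γA * par.ρ * (par.σmin * μs) ∧
      a * M ≤ par.γμ * μs / R / 2 := by
    refine eventually_mem_nhdsWithin.and ((eventually_mul_le _ one_pos).and
      ((eventually_mul_le _ (by positivity)).and ((eventually_mul_le _ ?_).and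
      ((eventually_mul_le _ (by positivity)).and ((eventually_mul_le _ (by positivity)).and
      (eventually_mul_le _ (by positivity)))))))
    have : 0 < 1 - par.γμ := by linarith
    positivity
  obtain ⟨a, ha0, ha1, c1, c2, c3, c4, c5⟩ := hev.exists
  rw [mul_one] at ha1
  refine ⟨a, ha0, ha1, fun s σ dx dy dz hs hσ hN => ?_⟩
  have hσ0 : 0 < σ := hσm.trans_le hσ.1
  have hσ1 : σ ≤ 1 / 2 := hσ.2.trans par.σmax_le
  obtain ⟨hdx, hdy, hdz⟩ := hM s σ dx dy dz hs hσ0.le (by linarith) hN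
  obtain ⟨⟨bt, ct, hp, hd, hb2, hbA⟩, hx, hz, hxz⟩ := hs.nbhd
  have hμ' := mu_newton_step hn hN.2.2 a
  have hμ1 := hs.le_mu
  have hμ2 := hs.mu_le
  have hxR : ∀ i, s.x i ≤ R := fun i => (le_abs_self _).trans ((norm_le_pi_norm s.x i).trans hs.x_le)
  have hzR : ∀ i, s.z i ≤ R := fun i => (le_abs_self _).trans ((norm_le_pi_norm s.z i).trans hs.z_le)
  have hcomp : ∀ i, par.γμ * μs ≤ s.x i * s.z i := fun i =>
    (mul_le_mul_of_nonneg_left hμ1 hγ.le).trans (hxz i)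
  have hstep : ∀ u v d : Fin n → ℝ, (∀ i, 0 < u i) → (∀ i, v i ≤ R) →
      (∀ i, par.γμ * μs ≤ u i * v i) → ‖d‖ ≤ M → ∀ i, 0 < (u + a • d) i := by
    intro u v d hu hv huv hd i
    have h1 : par.γμ * μs / R ≤ u i := by
      rw [div_le_iff₀ hR]
      exact (huv i).trans (mul_le_mul_of_nonneg_left (hv i) (hu i).le)
    have h2 : -(a * M) ≤ a * d i := by
      have := neg_le_of_abs_le ((norm_le_pi_norm d i).trans hd)
      nlinarith
    have h3 : 0 < par.γμ * μs / R := by positivity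
    simp only [Pi.add_apply, Pi.smul_apply, smul_eq_mul]
    linarith
  have hx' := hstep s.x s.z dx hx hzR hcomp hdx
  have hz' := hstep s.z s.x dz hz hxR (fun i => by rw [mul_comm (s.z i)]; exact hcomp i) hdz
  have hμ'0 : 0 < mu (s.x + a • dx) (s.z + a • dz) := by
    have : Nonempty (Fin n) := ⟨⟨0, hn⟩⟩
    exact div_pos (Finset.sum_pos (fun i _ => mul_pos (hx' i) (hz' i)) Finset.univ_nonempty) hn'
  have hg : |dx ⬝ᵥ dz / n| ≤ G := by
    rw [abs_div, abs_of_pos hn', div_le_iff₀ hn', hG, mul_comm]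
    exact (abs_dotProduct_le dx dz).trans (by gcongr)
  obtain ⟨r1, r2⟩ := newton_residuals hN hp hd hm0.ne' hμ'0.ne' hμ'
  have hcompl : ∀ i, (s.x + a • dx) i * (s.z + a • dz) i
      = (1 - a) * (s.x i * s.z i) + a * (σ * mu s.x s.z) + a ^ 2 * (dx i * dz i) := by
    intro i
    simp only [Pi.add_apply, Pi.smul_apply, smul_eq_mul]
    linear_combination a * hN.2.2 i
  have hdxdz : ∀ i, -G ≤ dx i * dz i := by
    intro i
    refine neg_le_of_abs_le ?_
    rw [abs_mul, hG]
    exact mul_le_mul ((norm_le_pi_norm dx i).trans hdx) ((norm_le_pi_norm dz i).trans hdz)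
      (abs_nonneg _) hM0
  generalize hstepμ : mu (s.x + a • dx) (s.z + a • dz) = μ' at hμ' hμ'0 r1 r2
  generalize dx ⬝ᵥ dz / (n : ℝ) = g at hμ' hg r1 r2
  obtain ⟨hg1, hg2⟩ := abs_le.1 hg
  generalize hμ : mu s.x s.z = μ at hμ' hμ1 hμ2 hxz r1 r2 hcompl
  have hμ0 : 0 < μ := hμs.trans_le hμ1
  have h1a : 0 ≤ 1 - a := by linarith
  have hσμ : par.σmin * μs ≤ σ * μ := mul_le_mul hσ.1 hμ1 hμs.le hσ0.le
  obtain ⟨ep, hep⟩ : ∃ e, e = g • (s.y - s.η) + ((σ - 1) * μ + a * g) • dy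
    - (g / mu0 n par) • bbar P par := ⟨_, rfl⟩
  obtain ⟨ed, hed⟩ : ∃ e, e = -(g • (s.x - s.ζ)) - ((σ - 1) * μ + a * g) • dx
    - (g / mu0 n par) • cbar P par y₀ := ⟨_, rfl⟩
  rw [← hep] at r1
  rw [← hed] at r2
  have hcoef : |(σ - 1) * μ + a * g| ≤ mu0 n par + G := by
    refine (abs_add_le _ _).trans (add_le_add ?_ ?_)
    · rw [abs_mul, abs_of_pos hμ0, abs_of_nonpos (by linarith)]; nlinarith
    · rw [abs_mul, abs_of_pos ha0]
      exact (mul_le_of_le_one_left (abs_nonneg _) ha1).trans hg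
  have hgdiv : |g / mu0 n par| ≤ G / mu0 n par := by
    rw [abs_div, abs_of_pos hm0]; gcongr
  have hmG : 0 ≤ mu0 n par + G := by positivity
  have hGd : 0 ≤ G / mu0 n par := by positivity
  have hepB : ‖ep‖ ≤ Ep := by
    rw [hep, hEp]
    refine (norm_sub_le _ _).trans (add_le_add ((norm_add_le _ _).trans (add_le_add ?_ ?_)) ?_) <;>
      rw [norm_smul, Real.norm_eq_abs]
    · exact mul_le_mul hg ((norm_sub_le _ _).trans (add_le_add hs.y_le hs.η_le)) (norm_nonneg _) hG0
    · exact mul_le_mul hcoef hdy (norm_nonneg _) hmG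
    · exact mul_le_mul hgdiv (le_add_of_nonneg_right (norm_nonneg _)) (norm_nonneg _) hGd
  have hedB : ‖ed‖ ≤ Ep := by
    rw [hed, hEp]
    refine (norm_sub_le _ _).trans (add_le_add ((norm_sub_le _ _).trans (add_le_add ?_ ?_)) ?_) <;>
      rw [← norm_neg] <;> simp only [neg_neg, norm_neg] <;> rw [norm_smul, Real.norm_eq_abs]
    · exact mul_le_mul hg ((norm_sub_le _ _).trans (add_le_add hs.x_le hs.ζ_le)) (norm_nonneg _) hG0
    · exact mul_le_mul hcoef hdx (norm_nonneg _) hmG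
    · exact mul_le_mul hgdiv (le_add_of_nonneg_left (norm_nonneg _)) (norm_nonneg _) hGd
  have hn2 : norm2 ep ed ≤ E := by
    refine (norm2_le_sum ep ed).trans ?_
    rw [hE]
    exact mul_le_mul (by linarith) (add_le_add hepB hedB) (by positivity) (by positivity)
  have hnA : normA P ep ed ≤ E := by
    refine (hKN ep ed).trans ?_
    rw [hE]
    exact mul_le_mul (by linarith) (add_le_add hepB hedB) (by positivity) (by positivity)
  have w1 : 0 ≤ (1 - a) * μ / μ' := by positivity
  have w2 : 0 ≤ a ^ 2 * mu0 n par / μ' := by positivity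
  have ha2 : 0 ≤ a ^ 2 := sq_nonneg a
  have hag : a ^ 2 * g ≤ a * (0.49 * μs) := by
    have := mul_le_mul_of_nonneg_left hg2 ha2
    have := mul_le_mul_of_nonneg_left c1 ha0.le
    linarith
  rw [admissible, Set.mem_ofPred_eq, hstepμ, hμ]
  refine ⟨ha0, ha1, ?_, ⟨⟨_, _, r1, r2, ?_, ?_⟩, hx', hz', fun i => ?_⟩⟩
  · rw [hμ']
    have t1 := mul_le_mul_of_nonneg_left (mul_le_mul_of_nonneg_right hσ1 hμ0.le) ha0.le
    have t2 := mul_le_mul_of_nonneg_left hμ1 ha0.le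
    linarith
  · exact (norm2_add_smul_le _ _ _ _ w1 w2).trans (damped_combination_le ha0 ha1 hμ0
      hm0 hμ'0 hg1 hσμ hμ' hCN.le hb2 hn2 c3)
  · exact (normA_add_smul_le hA _ _ _ _ w1 w2).trans (damped_combination_le ha0 ha1 hμ0
      hm0 hμ'0 hg1 hσμ hμ' (by positivity) hbA hnA c4)
  · rw [hcompl, hμ']
    have t1 := mul_le_mul_of_nonneg_left (hxz i) h1a
    have t2 := mul_le_mul_of_nonneg_left (hdxdz i) ha2
    have t3 := mul_le_mul_of_nonneg_left hg2 (mul_nonneg hγ.le ha2)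
    have t4 := mul_le_mul_of_nonneg_left c2 ha0.le
    have t5 := mul_le_mul_of_nonneg_left hσμ (mul_nonneg ha0.le (by linarith : 0 ≤ 1 - par.γμ))
    have t6 := mul_le_mul_of_nonneg_right hγ1.le (mul_nonneg ha2 hG0)
    linarith

/-! ### Invariants of a run -/

lemma InNbhd.mu_pos (hn : 0 < n) {μ : ℝ} {ζ x z : Fin n → ℝ} {η y : Fin m → ℝ}
    (h : InNbhd P par y₀ μ ζ η x y z) : 0 < mu x z := by
  have : Nonempty (Fin n) := ⟨⟨0, hn⟩⟩
  exact div_pos (Finset.sum_pos (fun i _ => mul_pos (h.2.1 i) (h.2.2.1 i))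
    Finset.univ_nonempty) (by exact_mod_cast hn)

lemma inNbhd_start (hn : 0 < n) (P : QP m n) (par : Params) (y₀ : Fin m → ℝ) :
    InNbhd P par y₀ (mu0 n par) (fun _ => par.ρ) y₀ (fun _ => par.ρ) y₀ (fun _ => par.ρ) := by
  have hρ := par.ρ_pos
  have hm : mu0 n par ≠ 0 := by rw [mu0_eq hn]; positivity
  refine ⟨⟨0, 0, ?_, ?_, ?_, ?_⟩, fun _ => hρ, fun _ => hρ, fun _ => ?_⟩
  · simp [div_self hm, bbar]
  · simp [div_self hm, cbar]
  · rw [norm2_zero]; exact par.CN_pos.le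
  · exact normA_zero_le.trans (mul_pos par.γA_pos hρ).le
  · rw [mu0_eq hn, ← sq]
    exact mul_le_of_le_one_left (sq_nonneg _) par.γμ_lt.le

/-- At `ζ = x`, `η = y` the proximal terms vanish, so the tested residuals, scaled by `μ₀/μ`, serve
as `bt` and `ct`. -/
lemma InNbhd.of_updateTest (hn : 0 < n) (hA : P.A.rank = m) {ζ x z : Fin n → ℝ} {η y : Fin m → ℝ}
    (h : InNbhd P par y₀ (mu x z) ζ η x y z) (hT : UpdateTest P par y₀ x y z) :
    InNbhd P par y₀ (mu x z) x y x y z := by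
  have hρ := par.ρ_pos
  have hm : 0 < mu0 n par := by rw [mu0_eq hn]; positivity
  have hμ := h.mu_pos hn
  obtain ⟨h1, h2⟩ := hT
  set rp := P.A *ᵥ x - (P.b + (mu x z / mu0 n par) • bbar P par) with hrp
  set rd := -(P.Q *ᵥ x) + P.Aᵀ *ᵥ y + z - (P.c + (mu x z / mu0 n par) • cbar P par y₀) with hrd
  have hk : (mu x z / mu0 n par) * (mu0 n par / mu x z) = 1 := by field_simp
  have hk0 : 0 ≤ mu0 n par / mu x z := by positivity
  refine ⟨⟨(mu0 n par / mu x z) • rp, (mu0 n par / mu x z) • rd, ?_, ?_, ?_, ?_⟩, h.2⟩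
  · rw [smul_add, smul_smul, hk, hrp]; simp; abel
  · rw [smul_add, smul_smul, hk, hrd]; simp; abel
  · rw [norm2_smul _ _ hk0]
    calc _ ≤ mu0 n par / mu x z * (par.CN * (mu x z / mu0 n par)) := by gcongr
      _ = _ := by field_simp
  · refine (normA_smul_le hA _ _ hk0).trans ?_
    calc _ ≤ mu0 n par / mu x z * (par.γA * par.ρ * (mu x z / mu0 n par)) := by gcongr
      _ = _ := by field_simp

lemma Step.inNbhd (hn : 0 < n) (hA : P.A.rank = m) {s t : State m n} (h : Step P par y₀ s t) :
    InNbhd P par y₀ (mu t.x t.z) t.ζ t.η t.x t.y t.z := by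
  obtain ⟨σ, a, dx, dy, dz, -, -, ⟨⟨-, -, -, hN⟩, -⟩, hx, hy, hz, hu, hu'⟩ := h
  rw [← hx, ← hy, ← hz] at hN
  by_cases hT : UpdateTest P par y₀ t.x t.y t.z
  · rw [(hu hT).1, (hu hT).2]
    exact hN.of_updateTest hn hA hT
  · rw [(hu' hT).1, (hu' hT).2]
    exact hN

lemma Step.prox_eq {s t : State m n} (h : Step P par y₀ s t) :
    (t.ζ = t.x ∧ t.η = t.y) ∨ (t.ζ = s.ζ ∧ t.η = s.η) := by
  obtain ⟨-, -, -, -, -, -, -, -, -, -, -, hu, hu'⟩ := h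
  by_cases hT : UpdateTest P par y₀ t.x t.y t.z
  · exact .inl (hu hT)
  · exact .inr (hu' hT)

lemma Step.mu_lt {s t : State m n} (h : Step P par y₀ s t)
    (hs : 0 < mu s.x s.z) : mu t.x t.z < mu s.x s.z := by
  obtain ⟨σ, a, dx, dy, dz, -, -, ⟨⟨ha, -, hle, -⟩, -⟩, hx, hy, hz, -, -⟩ := h
  rw [hx, hz]
  nlinarith [mul_pos ha hs]

lemma IsRun.inNbhd (hn : 0 < n) (hA : P.A.rank = m) {s : ℕ → State m n} (hs : IsRun P par y₀ s)
    (k : ℕ) : InNbhd P par y₀ (mu (s k).x (s k).z) (s k).ζ (s k).η (s k).x (s k).y (s k).z := by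
  cases k with
  | zero => rw [hs.1]; exact inNbhd_start hn P par y₀
  | succ k => exact (hs.2 k).inNbhd hn hA

lemma IsRun.antitone_mu (hn : 0 < n) (hA : P.A.rank = m) {s : ℕ → State m n}
    (hs : IsRun P par y₀ s) : Antitone fun k => mu (s k).x (s k).z :=
  antitone_nat_of_succ_le fun k => ((hs.2 k).mu_lt ((hs.inNbhd hn hA k).mu_pos hn)).le

lemma IsRun.mu_le_mu0 (hn : 0 < n) (hA : P.A.rank = m) {s : ℕ → State m n}
    (hs : IsRun P par y₀ s) (k : ℕ) : mu (s k).x (s k).z ≤ mu0 n par := by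
  have h := hs.antitone_mu hn hA (Nat.zero_le k)
  simp only [hs.1] at h
  exact h

/-! ### Bounded iterates, convergence of `μ`, and limit points -/

lemma IsRun.exists_bound (hn : 0 < n) (hQ : P.Q.PosSemidef) (hA : P.A.rank = m)
    {xs zs : Fin n → ℝ} {ys : Fin m → ℝ} (hsol : IsKKT P xs ys zs) {s : ℕ → State m n}
    (hs : IsRun P par y₀ s) : ∃ R, 0 < R ∧ ∀ k, ‖(s k).x‖ ≤ R ∧ ‖(s k).y‖ ≤ R ∧ ‖(s k).z‖ ≤ R ∧
      ‖(s k).ζ‖ ≤ R ∧ ‖(s k).η‖ ≤ R := by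
  -- The value `0` is arbitrary: `R₀` is used only where the estimates coincide with the iterate. It
  -- bounds freshly set estimates without any prior bound, so `D` does not grow in the induction.
  obtain ⟨R₀, hR₀⟩ := exists_bound_of_inNbhd hn hQ hA hsol par y₀ 0
  obtain ⟨D, hD⟩ : ∃ D, D = max R₀ (max ‖(s 0).ζ‖ ‖(s 0).η‖) := ⟨_, rfl⟩
  obtain ⟨R, hR⟩ := exists_bound_of_inNbhd hn hQ hA hsol par y₀ D
  have hprox : ∀ k, ‖(s k).ζ‖ ≤ D ∧ ‖(s k).η‖ ≤ D := by
    intro k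
    induction k with
    | zero => rw [hD]; simp
    | succ k ih =>
      rcases (hs.2 k).prox_eq with ⟨h1, h2⟩ | ⟨h1, h2⟩
      · obtain ⟨b1, b2, -⟩ := hR₀ _ _ _ _ _ (hs.mu_le_mu0 hn hA (k + 1))
          (hs.inNbhd hn hA (k + 1)) (.inl ⟨h1, h2⟩)
        rw [h1, h2, hD]
        exact ⟨b1.trans (le_max_left _ _), b2.trans (le_max_left _ _)⟩
      · rwa [h1, h2]
  refine ⟨max 1 (max R D), by positivity, fun k => ?_⟩
  obtain ⟨b1, b2, b3⟩ := hR _ _ _ _ _ (hs.mu_le_mu0 hn hA k) (hs.inNbhd hn hA k) (.inr (hprox k))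
  have l1 : R ≤ max 1 (max R D) := (le_max_left _ _).trans (le_max_right _ _)
  have l2 : D ≤ max 1 (max R D) := (le_max_right _ _).trans (le_max_right _ _)
  exact ⟨b1.trans l1, b2.trans l1, b3.trans l1, (hprox k).1.trans l2, (hprox k).2.trans l2⟩

lemma IsRun.tendsto_mu (hn : 0 < n) (hQ : P.Q.PosSemidef) (hA : P.A.rank = m)
    {xs zs : Fin n → ℝ} {ys : Fin m → ℝ} (hsol : IsKKT P xs ys zs) {s : ℕ → State m n}
    (hs : IsRun P par y₀ s) : Tendsto (fun k => mu (s k).x (s k).z) atTop (𝓝 0) := by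
  have hpos : ∀ k, 0 < mu (s k).x (s k).z := fun k => (hs.inNbhd hn hA k).mu_pos hn
  have hsmall : ∀ μs, 0 < μs → ∃ k, mu (s k).x (s k).z < μs := by
    intro μs hμs
    by_contra! hcon
    obtain ⟨R, hR0, hR⟩ := hs.exists_bound hn hQ hA hsol
    obtain ⟨a, ha0, ha1, ha⟩ := exists_admissible_step hn hQ hA par y₀ hR0 hμs
    have hdec : ∀ k, mu (s (k + 1)).x (s (k + 1)).z ≤ (1 - 0.01 * a) * mu (s k).x (s k).z := by
      intro k
      obtain ⟨σ, α, dx, dy, dz, hσ, hN, ⟨⟨-, -, hle, -⟩, hmax⟩, hx, -, hz, -, -⟩ := hs.2 k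
      obtain ⟨b1, b2, b3, b4, b5⟩ := hR k
      -- The chosen step-length is the greatest admissible one, hence at least `a`.
      have hα := hmax (ha (s k) σ dx dy dz ⟨hs.inNbhd hn hA k, hcon k, hs.mu_le_mu0 hn hA k,
        b1, b2, b3, b4, b5⟩ hσ hN)
      rw [hx, hz]
      refine hle.trans (mul_le_mul_of_nonneg_right ?_ (hpos k).le)
      linarith
    have hgeom : ∀ k, mu (s k).x (s k).z ≤ (1 - 0.01 * a) ^ k * mu0 n par := by
      intro k
      induction k with
      | zero => simpa using hs.mu_le_mu0 hn hA 0
      | succ k ih =>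
        calc _ ≤ (1 - 0.01 * a) * mu (s k).x (s k).z := hdec k
          _ ≤ (1 - 0.01 * a) * ((1 - 0.01 * a) ^ k * mu0 n par) :=
            mul_le_mul_of_nonneg_left ih (by linarith)
          _ = _ := by ring
    have hlim : Tendsto (fun k : ℕ => (1 - 0.01 * a) ^ k * mu0 n par) atTop (𝓝 (0 * mu0 n par)) :=
      (tendsto_pow_atTop_nhds_zero_of_lt_one (by linarith) (by linarith)).mul_const _
    rw [zero_mul] at hlim
    exact hμs.not_ge (ge_of_tendsto' hlim fun k => (hcon k).trans (hgeom k))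
  rw [Metric.tendsto_atTop]
  intro ε hε
  obtain ⟨N, hN⟩ := hsmall ε hε
  refine ⟨N, fun k hk => ?_⟩
  rw [Real.dist_eq, sub_zero, abs_of_pos (hpos k)]
  exact (hs.antitone_mu hn hA hk).trans_lt hN

/-- The neighbourhood equations write both residuals as `μ` times a vector bounded through the
iterates, the estimates and `CN`. They vanish in the limit even if the estimates do not converge. -/
lemma IsRun.isKKT_of_mapClusterPt (hn : 0 < n) (hQ : P.Q.PosSemidef) (hA : P.A.rank = m)
    {xs zs : Fin n → ℝ} {ys : Fin m → ℝ} (hsol : IsKKT P xs ys zs) {s : ℕ → State m n}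
    (hs : IsRun P par y₀ s) {x z : Fin n → ℝ} {y : Fin m → ℝ}
    (hlim : MapClusterPt (x, y, z) atTop fun k => ((s k).x, (s k).y, (s k).z)) :
    IsKKT P x y z := by
  have hm : 0 < mu0 n par := by rw [mu0_eq hn]; have := par.ρ_pos; positivity
  have hn' : (0 : ℝ) < n := by exact_mod_cast hn
  have hCN := par.CN_pos
  obtain ⟨φ, hφ, hconv⟩ := hlim.tendsto_subseq
  have hx : Tendsto (fun k => (s (φ k)).x) atTop (𝓝 x) := (continuous_fst.tendsto _).comp hconv
  have hyz := (continuous_snd.tendsto _).comp hconv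
  have hy : Tendsto (fun k => (s (φ k)).y) atTop (𝓝 y) := (continuous_fst.tendsto _).comp hyz
  have hz : Tendsto (fun k => (s (φ k)).z) atTop (𝓝 z) := (continuous_snd.tendsto _).comp hyz
  have hμ := (hs.tendsto_mu hn hQ hA hsol).comp hφ.tendsto_atTop
  have hN := fun k => hs.inNbhd hn hA (φ k)
  have hpos := fun k => (hN k).mu_pos hn
  obtain ⟨R, hR0, hR⟩ := hs.exists_bound hn hQ hA hsol
  have hcont : ∀ {p q : ℕ} (B : Matrix (Fin p) (Fin q) ℝ), Continuous fun v => B *ᵥ v :=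
    fun B => B.mulVecLin.continuous_of_finiteDimensional
  refine ⟨?_, ?_, fun i => ?_, fun i => ?_, fun i => ?_⟩
  · have h1 : Tendsto (fun k => P.c + P.Q *ᵥ (s (φ k)).x - P.Aᵀ *ᵥ (s (φ k)).y - (s (φ k)).z) atTop
        (𝓝 (P.c + P.Q *ᵥ x - P.Aᵀ *ᵥ y - z)) :=
      ((tendsto_const_nhds.add (((hcont P.Q).tendsto x).comp hx)).sub
        (((hcont P.Aᵀ).tendsto y).comp hy)).sub hz
    refine tendsto_nhds_unique h1 (squeeze_zero_norm (a := fun k => mu (s (φ k)).x (s (φ k)).z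
      * ((R + R) + (‖cbar P par y₀‖ + par.CN) / mu0 n par)) (fun k => ?_)
      (by simpa using hμ.mul_const ((R + R) + (‖cbar P par y₀‖ + par.CN) / mu0 n par)))
    obtain ⟨⟨bt, ct, -, hd, h2, -⟩, -⟩ := hN k
    obtain ⟨b1, -, -, b4, -⟩ := hR (φ k)
    have e : P.c + P.Q *ᵥ (s (φ k)).x - P.Aᵀ *ᵥ (s (φ k)).y - (s (φ k)).z
        = mu (s (φ k)).x (s (φ k)).z • (((s (φ k)).ζ - (s (φ k)).x)
          - (mu0 n par)⁻¹ • (cbar P par y₀ + ct)) := by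
      rw [eq_sub_of_add_eq hd.symm]
      module
    rw [e, norm_smul, Real.norm_of_nonneg (hpos k).le]
    refine mul_le_mul_of_nonneg_left ((norm_sub_le _ _).trans (add_le_add
      ((norm_sub_le _ _).trans (add_le_add b4 b1)) ?_)) (hpos k).le
    rw [norm_smul, norm_inv, Real.norm_of_nonneg hm.le, div_eq_inv_mul]
    gcongr
    exact (norm_add_le _ _).trans (add_le_add le_rfl ((norm_right_le_norm2 bt ct).trans h2))
  · have h1 : Tendsto (fun k => P.A *ᵥ (s (φ k)).x - P.b) atTop (𝓝 (P.A *ᵥ x - P.b)) :=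
      (((hcont P.A).tendsto x).comp hx).sub tendsto_const_nhds
    refine tendsto_nhds_unique h1 (squeeze_zero_norm (a := fun k => mu (s (φ k)).x (s (φ k)).z
      * ((R + R) + (‖bbar P par‖ + par.CN) / mu0 n par)) (fun k => ?_)
      (by simpa using hμ.mul_const ((R + R) + (‖bbar P par‖ + par.CN) / mu0 n par)))
    obtain ⟨⟨bt, ct, hp, -, h2, -⟩, -⟩ := hN k
    obtain ⟨-, b2, -, -, b5⟩ := hR (φ k)
    have e : P.A *ᵥ (s (φ k)).x - P.b
        = mu (s (φ k)).x (s (φ k)).z • (((s (φ k)).η - (s (φ k)).y)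
          + (mu0 n par)⁻¹ • (bbar P par + bt)) := by
      rw [eq_sub_of_add_eq hp]
      module
    rw [e, norm_smul, Real.norm_of_nonneg (hpos k).le]
    refine mul_le_mul_of_nonneg_left ((norm_add_le _ _).trans (add_le_add
      ((norm_sub_le _ _).trans (add_le_add b5 b2)) ?_)) (hpos k).le
    rw [norm_smul, norm_inv, Real.norm_of_nonneg hm.le, div_eq_inv_mul]
    gcongr
    exact (norm_add_le _ _).trans (add_le_add le_rfl ((norm_left_le_norm2 bt ct).trans h2))
  · refine tendsto_nhds_unique ((tendsto_pi_nhds.1 hx i).mul (tendsto_pi_nhds.1 hz i))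
      (squeeze_zero (g := fun k => n * mu (s (φ k)).x (s (φ k)).z) (fun k => ?_) (fun k => ?_)
        (by simpa using hμ.const_mul (n : ℝ)))
    · exact (mul_pos ((hN k).2.1 i) ((hN k).2.2.1 i)).le
    · have e : n * mu (s (φ k)).x (s (φ k)).z = (s (φ k)).x ⬝ᵥ (s (φ k)).z := by
        rw [mu]; field_simp
      rw [e]
      exact Finset.single_le_sum (f := fun i => (s (φ k)).x i * (s (φ k)).z i)
        (fun j _ => (mul_pos ((hN k).2.1 j) ((hN k).2.2.1 j)).le) (Finset.mem_univ i)
  · exact ge_of_tendsto' (tendsto_pi_nhds.1 hx i) fun k => ((hN k).2.1 i).le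
  · exact ge_of_tendsto' (tendsto_pi_nhds.1 hz i) fun k => ((hN k).2.2.1 i).le

end IPPMM

theorem theorem3 {m n : ℕ} (P : IPPMM.QP m n) (hQ : P.Q.PosSemidef)
    (hsol : ∃ (xs : Fin n → ℝ) (ys : Fin m → ℝ) (zs : Fin n → ℝ),
      IPPMM.IsPrimalDualSolution P xs ys zs)
    (hA : P.A.rank = m)
    (par : IPPMM.Params) (y₀ : Fin m → ℝ)
    (s : ℕ → IPPMM.State m n) (hs : IPPMM.IsRun P par y₀ s)
    (x : Fin n → ℝ) (y : Fin m → ℝ) (z : Fin n → ℝ)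
    (hlim : MapClusterPt (x, y, z) atTop (fun k => ((s k).x, (s k).y, (s k).z))) :
    IPPMM.IsPrimalDualSolution P x y z := by
  obtain ⟨xs, ys, zs, h⟩ := hsol
  rcases Nat.eq_zero_or_pos n with rfl | hn
  -- For `n = 0` the measure `μ` is a division by zero, but full row rank forces `m = 0` and every
  -- triple equals the given solution.
  · have hm : m = 0 := by
      rw [← hA]
      simpa using P.A.rank_le_width
    subst hm
    rwa [Subsingleton.elim x xs, Subsingleton.elim y ys, Subsingleton.elim z zs]
  · exact (hs.isKKT_of_mapClusterPt hn hQ hA h.1 hlim).isPrimalDualSolution hQ
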